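/- Let $\alpha=(\alpha_0,\alpha_1,\alpha_2)$, $\beta=(\beta_0,\beta_1,\beta_2)\in\mathbf C^3$ be such that $\alpha$ is not a multiple of $\beta$ and $(\alpha_1,\beta_1)$, $(\alpha_2,\beta_2)$, $(\beta_1,\beta_2)$ are all different from $(0,0)$. Write $\alpha\cdot x=\alpha_0x_0+\alpha_1x_1+\alpha_2x_2$, and let $f$ be the birational map $$f[x_0:x_1:x_2]=[x_0\,\beta\cdot x: x_2\,\beta\cdot x: x_0\,\alpha\cdot x]$$ of $\mathbf P^2$. Put $e_1=[0:1:0]$, $e_2=[0:0:1]$, $$p=[\beta_1\alpha_2-\beta_2\alpha_1:-\beta_0\alpha_2+\alpha_0\beta_2:\alpha_1\beta_0-\alpha_0\beta_1],\qquad q=[\beta_1(\beta_1\alpha_2):\beta_1(\alpha_1\beta_0-\alpha_0\beta_1):\alpha_1(\beta_1\alpha_2-\alpha_1\beta_2)],$$ and let $\Sigma_\gamma$ and $\Sigma_C$ be the lines $(\beta_1\alpha_0-\alpha_1\beta_0)x_0+(\beta_1\alpha_2-\alpha_1\beta_2)x_2=0$ and $(\alpha_1\beta_0-\alpha_0\beta_1)x_0+(\alpha_1\beta_2-\alpha_2\beta_1)x_1=0$.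 Let $Y$ be the blow-up of $\mathbf P^2$ at $e_1$ and $e_2$, and let $f_Y$ be the meromorphic map of $Y$ induced by $f$. For $n\ge0$ let $V_n$ be the set of parameters $(\alpha,\beta)$ with $\beta_2=0$ and $f^n(q)=p$; that is, the points $q,f_Y(q),\dots,f_Y^n(q)$ of $Y$ are defined, and the last one is $p$. Suppose that $(\alpha,\beta)\in V_n$. Let $X$ be the blow-up of $Y$ at the orbit $\{q,f_Y(q),\dots,f_Y^n(q)=p\}$, which is uniquely determined. Then the map $f_X:X\to X$ induced by $f$ is everywhere defined and biholomorphic, and its inverse is the map induced by $f^{-1}$. Moreover, the strict transform of $\Sigma_\gamma$ is the only exceptional curve of $f_Y$ (its exceptional curves are the curves which it maps to points), the strict transform of $\Sigma_C$ is the only exceptional curve of $f_Y^{-1}$, and neither $f_X$ nor $f_X^{-1}$ has an exceptional curve. -/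

import Mathlib

open scoped Manifold ContDiff Topology LinearAlgebra.Projectivization

noncomputable section

/-! ### Complex surfaces from holomorphically compatible charts -/

/-- A family of charts with values in `ℂ × ℂ` on a bare set `X`, covering `X`, whose transition maps
are holomorphic on open sets. -/
structure SurfaceAtlas (X : Type*) where
  atlas : Set (PartialEquiv X (ℂ × ℂ))
  chartAt : X → PartialEquiv X (ℂ × ℂ)
  mem_chart_source : ∀ x, x ∈ (chartAt x).source
  chart_mem_atlas : ∀ x, chartAt x ∈ atlas
  compat : ∀ e ∈ atlas, ∀ e' ∈ atlas, ∀ z ∈ (e.symm.trans e').source,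
    (e.symm.trans e').source ∈ 𝓝 z ∧ ContDiffAt ℂ ω (e.symm.trans e') z

namespace SurfaceAtlas

variable {X : Type*} (c : SurfaceAtlas X)

/-- The associated gluing data in the sense of Mathlib. -/
def toCore : ChartedSpaceCore (ℂ × ℂ) X where
  atlas := c.atlas
  chartAt := c.chartAt
  mem_chart_source := c.mem_chart_source
  chart_mem_atlas := c.chart_mem_atlas
  open_source e e' he he' := isOpen_iff_mem_nhds.2 fun z hz => (c.compat e he e' he' z hz).1
  continuousOn_toFun e e' he he' := fun z hz =>
    (c.compat e he e' he' z hz).2.continuousAt.continuousWithinAt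

theorem isManifold :
    @IsManifold ℂ _ (ℂ × ℂ) _ _ (ℂ × ℂ) _ 𝓘(ℂ, ℂ × ℂ) ω X c.toCore.toTopologicalSpace
      c.toCore.toChartedSpace := by
  let : TopologicalSpace X := c.toCore.toTopologicalSpace
  let : ChartedSpace (ℂ × ℂ) X := c.toCore.toChartedSpace
  apply isManifold_of_contDiffOn
  intro e e' he he'
  obtain ⟨d, hd, rfl⟩ : ∃ d, ∃ hd : d ∈ c.atlas, e = c.toCore.openPartialHomeomorph d hd := by
    obtain ⟨d, hd⟩ := Set.mem_iUnion.1 he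
    obtain ⟨hd, h⟩ := Set.mem_iUnion.1 hd
    exact ⟨d, hd, h⟩
  obtain ⟨d', hd', rfl⟩ : ∃ d, ∃ hd : d ∈ c.atlas, e' = c.toCore.openPartialHomeomorph d hd := by
    obtain ⟨d, hd⟩ := Set.mem_iUnion.1 he'
    obtain ⟨hd, h⟩ := Set.mem_iUnion.1 hd
    exact ⟨d, hd, h⟩
  intro z hz
  have hz' : z ∈ (d.symm.trans d').source := hz.1
  exact (c.compat d hd d' hd' z hz').2.contDiffWithinAt

end SurfaceAtlas

/-! ### The complex projective plane -/

/-- The complex projective plane. -/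
abbrev P2 : Type := ℙ ℂ (Fin 3 → ℂ)

namespace P2

/-- The vector with `i`-th coordinate `1` and the next two coordinates (in cyclic order) `z`. -/
def affineVec (i : Fin 3) (z : ℂ × ℂ) : Fin 3 → ℂ :=
  fun k => if k = i then 1 else if k = i + 1 then z.1 else z.2

theorem affineVec_self (i : Fin 3) (z : ℂ × ℂ) : affineVec i z i = 1 := by simp [affineVec]

theorem affineVec_ne_zero (i : Fin 3) (z : ℂ × ℂ) : affineVec i z ≠ 0 := fun h => by
  have := affineVec_self i z
  simp [h] at this

theorem affineVec_contDiff (i k : Fin 3) : ContDiff ℂ ω (fun z => affineVec i z k) := by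
  unfold affineVec
  split_ifs <;> fun_prop

theorem rep_mk_div (v : Fin 3 → ℂ) (hv : v ≠ 0) :
    ∃ a : ℂ, a ≠ 0 ∧ ∀ i, (Projectivization.mk ℂ v hv).rep i = a * v i := by
  obtain ⟨a, ha⟩ := Projectivization.exists_smul_eq_mk_rep ℂ v hv
  exact ⟨a, a.ne_zero, fun i => by rw [← ha]; rfl⟩

/-- The standard affine chart of the projective plane on the set where the `i`-th homogeneous
coordinate does not vanish. -/
def chart (i : Fin 3) : PartialEquiv P2 (ℂ × ℂ) where
  toFun P := (P.rep (i + 1) / P.rep i, P.rep (i + 2) / P.rep i)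
  invFun z := Projectivization.mk ℂ (affineVec i z) (affineVec_ne_zero i z)
  source := {P | P.rep i ≠ 0}
  target := Set.univ
  map_source' _ _ := Set.mem_univ _
  map_target' z _ := by
    obtain ⟨a, ha, h⟩ := rep_mk_div _ (affineVec_ne_zero i z)
    simp [h, affineVec_self, ha]
  left_inv' P hP := by
    have hP' : P.rep i ≠ 0 := hP
    conv_rhs => rw [← P.mk_rep]
    rw [Projectivization.mk_eq_mk_iff']
    refine ⟨(P.rep i)⁻¹, funext fun k => ?_⟩
    fin_cases i <;> fin_cases k <;> simp_all [affineVec] <;> field_simp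
  right_inv' z _ := by
    obtain ⟨a, ha, h⟩ := rep_mk_div _ (affineVec_ne_zero i z)
    simp only [h, affineVec_self]
    fin_cases i <;> simp [affineVec, ha]

/-- The three standard affine charts. -/
def surfaceAtlas : SurfaceAtlas P2 where
  atlas := Set.range chart
  chartAt P := chart (Classical.choose (Function.ne_iff.1 P.rep_nonzero))
  mem_chart_source P := Classical.choose_spec (Function.ne_iff.1 P.rep_nonzero)
  chart_mem_atlas _ := ⟨_, rfl⟩
  compat := by
    rintro _ ⟨i, rfl⟩ _ ⟨j, rfl⟩ z hz
    have key : ∀ k w, affineVec i w j ≠ 0 →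
        (Projectivization.mk ℂ _ (affineVec_ne_zero i w)).rep k /
          (Projectivization.mk ℂ _ (affineVec_ne_zero i w)).rep j =
        affineVec i w k / affineVec i w j := by
      intro k w hw
      obtain ⟨a, ha, h⟩ := rep_mk_div _ (affineVec_ne_zero i w)
      rw [h, h, mul_div_mul_left _ _ ha]
    have hs : ((chart i).symm.trans (chart j)).source = {w | affineVec i w j ≠ 0} := by
      ext w
      obtain ⟨a, ha, h⟩ := rep_mk_div _ (affineVec_ne_zero i w)
      simp [chart, PartialEquiv.trans_source, h, ha]
    have ho : IsOpen {w | affineVec i w j ≠ 0} :=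
      isOpen_ne_fun (affineVec_contDiff i j).continuous continuous_const
    rw [hs] at hz ⊢
    refine ⟨ho.mem_nhds hz, ?_⟩
    have : ContDiffAt ℂ ω (fun w => (affineVec i w (j + 1) / affineVec i w j,
        affineVec i w (j + 2) / affineVec i w j)) z :=
      ((affineVec_contDiff i _).contDiffAt.div (affineVec_contDiff i _).contDiffAt hz).prodMk
        ((affineVec_contDiff i _).contDiffAt.div (affineVec_contDiff i _).contDiffAt hz)
    refine this.congr_of_eventuallyEq ?_
    filter_upwards [ho.mem_nhds hz] with w hw
    simp only [chart, PartialEquiv.coe_trans, Function.comp_apply, PartialEquiv.symm,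
      PartialEquiv.coe_mk]
    exact Prod.ext (key _ w hw) (key _ w hw)

instance : TopologicalSpace P2 := surfaceAtlas.toCore.toTopologicalSpace

instance : ChartedSpace (ℂ × ℂ) P2 := surfaceAtlas.toCore.toChartedSpace

instance : IsManifold 𝓘(ℂ, ℂ × ℂ) ω P2 := surfaceAtlas.isManifold

end P2

/-! ### Blowing up finitely many points of a complex surface -/

/-- The blow-up of a complex surface `M` at a finite set `S` of points: every point `s ∈ S` is
replaced by the projective line of tangent directions at `s` (in Mathlib the tangent space
of `M` at `s` is the model space `ℂ × ℂ`, through the preferred chart at `s`). -/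
inductive Blowup {M : Type*} (S : Finset M)
  | pt (x : M) (hx : x ∉ S)
  | dir (s : M) (hs : s ∈ S) (v : ℙ ℂ (ℂ × ℂ))

namespace Blowup

/-- The blow-down map. -/
def proj {M : Type*} {S : Finset M} : Blowup S → M
  | pt x _ => x
  | dir s _ _ => s

variable {M : Type*} [TopologicalSpace M] [ChartedSpace (ℂ × ℂ) M] (S : Finset M)

open Classical in
/-- Away from `S`, the blow-up has the charts of `M`. -/
def ptChart (x : M) (hx : x ∉ S) : PartialEquiv (Blowup S) (ℂ × ℂ) where
  toFun b := chartAt (ℂ × ℂ) x b.proj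
  invFun z := if h : (chartAt (ℂ × ℂ) x).symm z ∉ S then pt _ h else pt x hx
  source := {b | b.proj ∉ S ∧ b.proj ∈ (chartAt (ℂ × ℂ) x).source}
  target := {z | z ∈ (chartAt (ℂ × ℂ) x).target ∧ (chartAt (ℂ × ℂ) x).symm z ∉ S}
  map_source' b hb := by
    simp only [Set.mem_ofPred_eq] at hb ⊢
    exact ⟨(chartAt _ x).map_source hb.2, by rw [(chartAt _ x).left_inv hb.2]; exact hb.1⟩
  map_target' z hz := by
    simp only [Set.mem_ofPred_eq] at hz ⊢
    rw [dif_pos hz.2]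
    exact ⟨hz.2, (chartAt _ x).map_target hz.1⟩
  left_inv' b hb := by
    cases b with
    | pt y hy =>
      have h : (chartAt (ℂ × ℂ) x).symm (chartAt (ℂ × ℂ) x y) = y := (chartAt _ x).left_inv hb.2
      simp [proj, h, hy]
    | dir s hs v => exact absurd hs hb.1
  right_inv' z hz := by
    rw [dif_pos hz.2]
    exact (chartAt _ x).right_inv hz.1

theorem line_ne_zero (A : (ℂ × ℂ) ≃L[ℂ] ℂ × ℂ) (m : ℂ) : A.symm (1, m) ≠ 0 := by
  simp

theorem rep_mk (v : ℂ × ℂ) (hv : v ≠ 0) :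
    ∃ a : ℂ, a ≠ 0 ∧ (Projectivization.mk ℂ v hv).rep = a • v := by
  obtain ⟨a, ha⟩ := Projectivization.exists_smul_eq_mk_rep ℂ v hv
  exact ⟨a, a.ne_zero, ha.symm⟩

/-- The point of `ℂ × ℂ` below the point with coordinates `z = (a, m)` of the blow-up of the origin,
placed at `p` and transformed linearly by `A`: it is `p + A⁻¹ (a, a * m)`. -/
def down (A : (ℂ × ℂ) ≃L[ℂ] ℂ × ℂ) (p z : ℂ × ℂ) : ℂ × ℂ := p + A.symm (z.1, z.1 * z.2)

theorem down_contDiff (A : (ℂ × ℂ) ≃L[ℂ] ℂ × ℂ) (p : ℂ × ℂ) : ContDiff ℂ ω (down A p) := by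
  unfold down
  have : ContDiff ℂ ω (fun z : ℂ × ℂ => (z.1, z.1 * z.2)) := by fun_prop
  exact contDiff_const.add (A.symm.contDiff.comp this)

theorem down_eq_self {A : (ℂ × ℂ) ≃L[ℂ] ℂ × ℂ} {p z : ℂ × ℂ} : down A p z = p ↔ z.1 = 0 := by
  unfold down
  simp only [add_eq_left, EmbeddingLike.map_eq_zero_iff]
  constructor
  · exact fun h => congrArg Prod.fst h
  · intro h; simp [h]

open Classical in
/-- The chart near directions at `s ∈ S`. If `(u, v)` are the coordinates of a point near `s`, centred
at `s` and transformed linearly by `A`, then it is `(u, v) ↦ (u, v / u)`, and the direction of `(u, v)`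
goes to `(0, v / u)`. -/
def dirChart (s : M) (hs : s ∈ S) (A : (ℂ × ℂ) ≃L[ℂ] ℂ × ℂ) :
    PartialEquiv (Blowup S) (ℂ × ℂ) where
  toFun
    | pt x _ => ((A (chartAt (ℂ × ℂ) s x - chartAt (ℂ × ℂ) s s)).1,
        (A (chartAt (ℂ × ℂ) s x - chartAt (ℂ × ℂ) s s)).2 /
          (A (chartAt (ℂ × ℂ) s x - chartAt (ℂ × ℂ) s s)).1)
    | dir _ _ v => (0, (A v.rep).2 / (A v.rep).1)
  invFun z :=
    if h : z.1 ≠ 0 ∧ (chartAt (ℂ × ℂ) s).symm (down A (chartAt (ℂ × ℂ) s s) z) ∉ S then pt _ h.2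
    else dir s hs (Projectivization.mk ℂ (A.symm (1, z.2)) (line_ne_zero A z.2))
  source := {b | match b with
    | pt x _ => x ∈ (chartAt (ℂ × ℂ) s).source ∧
        (A (chartAt (ℂ × ℂ) s x - chartAt (ℂ × ℂ) s s)).1 ≠ 0
    | dir t _ v => t = s ∧ (A v.rep).1 ≠ 0}
  target := {z | down A (chartAt (ℂ × ℂ) s s) z ∈ (chartAt (ℂ × ℂ) s).target ∧
    (z.1 ≠ 0 → (chartAt (ℂ × ℂ) s).symm (down A (chartAt (ℂ × ℂ) s s) z) ∉ S)}
  map_source' b hb := by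
    cases b with
    | pt x hx =>
      obtain ⟨h1, h2⟩ := hb
      have : down A (chartAt (ℂ × ℂ) s s)
          ((A (chartAt (ℂ × ℂ) s x - chartAt (ℂ × ℂ) s s)).1,
          (A (chartAt (ℂ × ℂ) s x - chartAt (ℂ × ℂ) s s)).2 /
          (A (chartAt (ℂ × ℂ) s x - chartAt (ℂ × ℂ) s s)).1) = chartAt (ℂ × ℂ) s x := by
        unfold down
        simp only [mul_div_cancel₀ _ h2, Prod.mk.eta, ContinuousLinearEquiv.symm_apply_apply]
        abel
      simp only [Set.mem_ofPred_eq, this]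
      exact ⟨(chartAt _ s).map_source h1, fun _ => by rwa [(chartAt _ s).left_inv h1]⟩
    | dir t ht v =>
      refine ⟨?_, fun h => absurd rfl h⟩
      rw [down_eq_self.2 rfl]
      exact mem_chart_target _ s
  map_target' z hz := by
    obtain ⟨h1, h2⟩ := hz
    by_cases h0 : z.1 = 0
    · rw [dif_neg (fun h => h.1 h0)]
      obtain ⟨a, ha, h⟩ := rep_mk _ (line_ne_zero A z.2)
      exact ⟨rfl, by simp [h, ha]⟩
    · rw [dif_pos ⟨h0, h2 h0⟩]
      refine ⟨(chartAt _ s).map_target h1, ?_⟩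
      rw [(chartAt _ s).right_inv h1]
      simpa [down] using h0
  left_inv' b hb := by
    cases b with
    | pt x hx =>
      obtain ⟨h1, h2⟩ := hb
      have : down A (chartAt (ℂ × ℂ) s s)
          ((A (chartAt (ℂ × ℂ) s x - chartAt (ℂ × ℂ) s s)).1,
          (A (chartAt (ℂ × ℂ) s x - chartAt (ℂ × ℂ) s s)).2 /
          (A (chartAt (ℂ × ℂ) s x - chartAt (ℂ × ℂ) s s)).1) = chartAt (ℂ × ℂ) s x := by
        unfold down
        simp only [mul_div_cancel₀ _ h2, Prod.mk.eta, ContinuousLinearEquiv.symm_apply_apply]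
        abel
      simp only [this, (chartAt (ℂ × ℂ) s).left_inv h1]
      rw [dif_pos ⟨h2, hx⟩]
    | dir t ht v =>
      obtain ⟨rfl, h2⟩ := hb
      rw [dif_neg (fun h => h.1 rfl)]
      congr 1
      conv_rhs => rw [← v.mk_rep]
      rw [Projectivization.mk_eq_mk_iff']
      refine ⟨((A v.rep).1)⁻¹, ?_⟩
      apply A.injective
      rw [map_smul, A.apply_symm_apply]
      exact Prod.ext (by simp [h2]) (by simp [div_eq_inv_mul])
  right_inv' z hz := by
    obtain ⟨h1, h2⟩ := hz
    by_cases h0 : z.1 = 0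
    · rw [dif_neg (fun h => h.1 h0)]
      obtain ⟨a, ha, h⟩ := rep_mk _ (line_ne_zero A z.2)
      exact Prod.ext h0.symm (by simp [h, ha])
    · rw [dif_pos ⟨h0, h2 h0⟩]
      simp only [(chartAt (ℂ × ℂ) s).right_inv h1]
      simp [down, h0]

variable {S}

/-- Away from the exceptional curves, the inverses of the charts are holomorphic. -/
theorem chart_symm_pt {e : PartialEquiv (Blowup S) (ℂ × ℂ)}
    (he : (∃ x hx, e = ptChart S x hx) ∨ ∃ s hs A, e = dirChart S s hs A) {z : ℂ × ℂ}
    (hz : z ∈ e.target) {x₀ : M} {h₀ : x₀ ∉ S} (hx : e.symm z = pt x₀ h₀) :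
    ∃ ψ ∈ atlas (ℂ × ℂ) M, ∃ g : ℂ × ℂ → ℂ × ℂ, ContDiffAt ℂ ω g z ∧ g z ∈ ψ.target ∧
      ψ.symm (g z) = x₀ ∧
      ∀ᶠ w in 𝓝 z, w ∈ e.target ∧ ∃ h, e.symm w = pt (ψ.symm (g w)) h := by
  have : T1Space M := ChartedSpace.t1Space (ℂ × ℂ) M
  have hS : IsOpen (S : Set M)ᶜ := S.finite_toSet.isClosed.isOpen_compl
  obtain ⟨x, hxS, rfl⟩ | ⟨s, hs, A, rfl⟩ := he
  · obtain ⟨h1, h2⟩ := hz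
    have e1 : ∀ w (h : (chartAt (ℂ × ℂ) x).symm w ∉ S), (ptChart S x hxS).symm w = pt _ h :=
      fun w h => dif_pos h
    refine ⟨chartAt _ x, chart_mem_atlas _ x, id, contDiffAt_id, h1, ?_, ?_⟩
    · rw [e1 z h2] at hx
      exact (pt.injEq _ _ _ _).mp hx
    · have hc := (chartAt (ℂ × ℂ) x).continuousAt_symm h1
      filter_upwards [(chartAt (ℂ × ℂ) x).open_target.mem_nhds h1,
        hc.eventually (hS.mem_nhds h2)] with w hw1 hw2
      exact ⟨⟨hw1, hw2⟩, hw2, e1 w hw2⟩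
  · obtain ⟨h1, h2⟩ := hz
    have e1 : ∀ w (h : w.1 ≠ 0 ∧
        (chartAt (ℂ × ℂ) s).symm (down A (chartAt (ℂ × ℂ) s s) w) ∉ S),
        (dirChart S s hs A).symm w = pt _ h.2 := fun w h => dif_pos h
    have h0 : z.1 ≠ 0 := by
      intro h0
      have : (dirChart S s hs A).symm z = dir s hs _ := dif_neg (fun h => h.1 h0)
      rw [this] at hx
      cases hx
    refine ⟨chartAt _ s, chart_mem_atlas _ s, down A (chartAt (ℂ × ℂ) s s),
      (down_contDiff _ _).contDiffAt, h1, ?_, ?_⟩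
    · rw [e1 z ⟨h0, h2 h0⟩] at hx
      exact (pt.injEq _ _ _ _).mp hx
    · have hd := (down_contDiff A (chartAt (ℂ × ℂ) s s)).continuous.continuousAt (x := z)
      have hc := ((chartAt (ℂ × ℂ) s).continuousAt_symm h1).comp hd
      filter_upwards [hd.eventually ((chartAt (ℂ × ℂ) s).open_target.mem_nhds h1),
        hc.eventually (hS.mem_nhds (h2 h0)),
        (isOpen_ne_fun continuous_fst continuous_const).mem_nhds h0] with w hw1 hw2 hw3
      exact ⟨⟨hw1, fun _ => hw2⟩, hw2, e1 w ⟨hw3, hw2⟩⟩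

/-- Away from the exceptional curves, the charts are holomorphic. -/
theorem chart_pt {e : PartialEquiv (Blowup S) (ℂ × ℂ)}
    (he : (∃ x hx, e = ptChart S x hx) ∨ ∃ s hs A, e = dirChart S s hs A)
    {x₀ : M} {h₀ : x₀ ∉ S} (hx : pt x₀ h₀ ∈ e.source) :
    ∃ ψ ∈ atlas (ℂ × ℂ) M, x₀ ∈ ψ.source ∧ ∃ g : ℂ × ℂ → ℂ × ℂ, ContDiffAt ℂ ω g (ψ x₀) ∧
      ∀ᶠ x in 𝓝 x₀, ∀ h, pt x h ∈ e.source ∧ e (pt x h) = g (ψ x) := by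
  obtain ⟨x, hxS, rfl⟩ | ⟨s, hs, A, rfl⟩ := he
  · obtain ⟨h1, h2⟩ := hx
    refine ⟨chartAt _ x, chart_mem_atlas _ x, h2, id, contDiffAt_id, ?_⟩
    filter_upwards [(chartAt (ℂ × ℂ) x).open_source.mem_nhds h2] with y hy h
    exact ⟨⟨h, hy⟩, rfl⟩
  · obtain ⟨h1, h2⟩ := hx
    refine ⟨chartAt _ s, chart_mem_atlas _ s, h1,
      fun w => ((A (w - chartAt (ℂ × ℂ) s s)).1,
        (A (w - chartAt (ℂ × ℂ) s s)).2 / (A (w - chartAt (ℂ × ℂ) s s)).1), ?_, ?_⟩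
    · have hA : ContDiff ℂ ω (fun w => A (w - chartAt (ℂ × ℂ) s s)) :=
        A.contDiff.comp (contDiff_id.sub contDiff_const)
      exact hA.fst.contDiffAt.prodMk (hA.snd.contDiffAt.div hA.fst.contDiffAt h2)
    · have hc : ContinuousAt (fun x => (A (chartAt (ℂ × ℂ) s x - chartAt (ℂ × ℂ) s s)).1) x₀ := by
        have := (chartAt (ℂ × ℂ) s).continuousAt h1
        fun_prop
      filter_upwards [(chartAt (ℂ × ℂ) s).open_source.mem_nhds h1,
        hc.eventually (isOpen_ne.mem_nhds h2)] with y hy1 hy2 h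
      exact ⟨⟨hy1, hy2⟩, rfl⟩

variable (S) in
open Classical in
/-- The charts of the blow-up. -/
def surfaceAtlas [IsManifold 𝓘(ℂ, ℂ × ℂ) ω M] : SurfaceAtlas (Blowup S) where
  atlas := {e | (∃ x hx, e = ptChart S x hx) ∨ ∃ s hs A, e = dirChart S s hs A}
  chartAt
    | pt x hx => ptChart S x hx
    | dir s hs v =>
      if v.rep.1 ≠ 0 then dirChart S s hs (ContinuousLinearEquiv.refl ℂ (ℂ × ℂ))
      else dirChart S s hs (ContinuousLinearEquiv.prodComm ℂ ℂ ℂ)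
  mem_chart_source b := by
    cases b with
    | pt x hx => exact ⟨hx, mem_chart_source _ x⟩
    | dir s hs v =>
      by_cases h : v.rep.1 ≠ 0
      · simp only [if_pos h]
        exact ⟨rfl, h⟩
      · simp only [if_neg h]
        refine ⟨rfl, fun h' => v.rep_nonzero ?_⟩
        exact Prod.ext (not_not.1 h) h'
  chart_mem_atlas b := by
    cases b with
    | pt x hx => exact Or.inl ⟨x, hx, rfl⟩
    | dir s hs v =>
      dsimp only
      split_ifs
      · exact Or.inr ⟨s, hs, _, rfl⟩
      · exact Or.inr ⟨s, hs, _, rfl⟩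
  compat := by
    intro e he e' he' z hz
    have hz1 : z ∈ e.target := hz.1
    have hz2 : e.symm z ∈ e'.source := hz.2
    -- it suffices to find a holomorphic expression near `z`
    suffices ∃ g : ℂ × ℂ → ℂ × ℂ, ContDiffAt ℂ ω g z ∧
        ∀ᶠ w in 𝓝 z, w ∈ e.target ∧ e.symm w ∈ e'.source ∧ e' (e.symm w) = g w by
      obtain ⟨g, hg, h⟩ := this
      exact ⟨h.mono fun w hw => ⟨hw.1, hw.2.1⟩, hg.congr_of_eventuallyEq (h.mono fun w hw => hw.2.2)⟩
    rcases hb : e.symm z with ⟨x₀, h₀⟩ | ⟨t, ht, v⟩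
    · rw [hb] at hz2
      obtain ⟨ψ, hψ, g, hg, hgz, hx₀, hev⟩ := chart_symm_pt he hz1 hb
      obtain ⟨ψ', hψ', hx₀', g', hg', hev'⟩ := chart_pt he' hz2
      have hc : ContinuousAt (fun w => ψ.symm (g w)) z :=
        (ψ.continuousAt_symm hgz).comp hg.continuousAt
      refine ⟨fun w => g' (ψ' (ψ.symm (g w))), ?_, ?_⟩
      · have htr : ContDiffAt ℂ ω (ψ' ∘ ψ.symm) (g z) := by
          have h := ModelWithCorners.contDiffOn_extendCoordChange (I := 𝓘(ℂ, ℂ × ℂ)) (n := ω)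
            (IsManifold.subset_maximalAtlas hψ) (IsManifold.subset_maximalAtlas hψ')
          have hm : g z ∈ (ψ.symm.trans ψ').source := by
            simp [hgz, hx₀, hx₀']
          simp only [mfld_simps] at h
          exact h.contDiffAt ((ψ.symm.trans ψ').open_source.mem_nhds hm)
        have h2 : ContDiffAt ℂ ω (fun w => (ψ' ∘ ψ.symm) (g w)) z := htr.comp z hg
        refine ContDiffAt.comp z (g := g') (f := fun w => (ψ' ∘ ψ.symm) (g w)) ?_ h2
        simpa [hx₀] using hg'
      · have hev'' := hc.eventually (p := fun x => ∀ h, pt x h ∈ e'.source ∧ e' (pt x h) = g' (ψ' x))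
          (by simpa only [hx₀] using hev')
        filter_upwards [hev, hev''] with w hw hw'
        obtain ⟨h1, h2, h3⟩ := hw
        rw [h3]
        exact ⟨h1, hw' h2⟩
    · rw [hb] at hz2
      obtain ⟨x, hxS, rfl⟩ | ⟨s', hs', A', rfl⟩ := he'
      · exact absurd ht hz2.1
      obtain ⟨rfl, hv⟩ := hz2
      obtain ⟨x, hxS, rfl⟩ | ⟨s, hs, A, rfl⟩ := he
      · obtain ⟨_, h2⟩ := hz1
        rw [show (ptChart S x hxS).symm z = pt _ h2 from dif_pos h2] at hb
        cases hb
      have e1 : ∀ w (h : w.1 ≠ 0 ∧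
          (chartAt (ℂ × ℂ) s).symm (down A (chartAt (ℂ × ℂ) s s) w) ∉ S),
          (dirChart S s hs A).symm w = pt _ h.2 := fun w h => dif_pos h
      have e2 : ∀ w : ℂ × ℂ, w.1 = 0 → (dirChart S s hs A).symm w =
          dir s hs (Projectivization.mk ℂ (A.symm (1, w.2)) (line_ne_zero A w.2)) :=
        fun w h => dif_neg (fun h' => h'.1 h)
      obtain ⟨h1, h2⟩ := hz1
      have h0 : z.1 = 0 := by
        by_contra h0
        rw [e1 z ⟨h0, h2 h0⟩] at hb
        cases hb
      rw [e2 z h0] at hb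
      obtain ⟨rfl, rfl⟩ := (dir.injEq _ _ _ _ _ _).mp hb
      have hB : ContDiff ℂ ω (fun w : ℂ × ℂ => A' (A.symm (1, w.2))) :=
        A'.contDiff.comp (A.symm.contDiff.comp (contDiff_const.prodMk contDiff_snd))
      have hBz : (A' (A.symm (1, z.2))).1 ≠ 0 := by
        obtain ⟨a, ha, h⟩ := rep_mk _ (line_ne_zero A z.2)
        rw [h, map_smul] at hv
        exact fun h' => hv (by simp [h'])
      refine ⟨fun w => (w.1 * (A' (A.symm (1, w.2))).1,
        (A' (A.symm (1, w.2))).2 / (A' (A.symm (1, w.2))).1), ?_, ?_⟩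
      · exact (contDiff_fst.contDiffAt.mul hB.fst.contDiffAt).prodMk
          (hB.snd.contDiffAt.div hB.fst.contDiffAt hBz)
      · have hd := (down_contDiff A (chartAt (ℂ × ℂ) s s)).continuous.continuousAt (x := z)
        have hc := ((chartAt (ℂ × ℂ) s).continuousAt_symm h1).comp hd
        have hzs : (chartAt (ℂ × ℂ) s).symm (down A (chartAt (ℂ × ℂ) s s) z) = s := by
          rw [down_eq_self.2 h0]
          exact (chartAt (ℂ × ℂ) s).left_inv (mem_chart_source _ s)
        have : T1Space M := ChartedSpace.t1Space (ℂ × ℂ) M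
        have hS : IsOpen (S.erase s : Set M)ᶜ := (S.erase s).finite_toSet.isClosed.isOpen_compl
        filter_upwards [hd.eventually ((chartAt (ℂ × ℂ) s).open_target.mem_nhds h1),
          hc.eventually (hS.mem_nhds (by simp [hzs])),
          hB.fst.continuous.continuousAt.eventually (isOpen_ne.mem_nhds hBz)] with w hw1 hw2 hw3
        by_cases hw0 : w.1 = 0
        · refine ⟨⟨hw1, fun h => absurd hw0 h⟩, ?_⟩
          obtain ⟨a, ha, h⟩ := rep_mk _ (line_ne_zero A w.2)
          rw [e2 w hw0]
          refine ⟨⟨rfl, ?_⟩, ?_⟩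
          · rw [h, map_smul]
            exact mul_ne_zero ha hw3
          · refine Prod.ext ?_ ?_
            · simp [dirChart, hw0]
            · simp only [dirChart, h, map_smul, Prod.smul_fst, Prod.smul_snd, smul_eq_mul]
              exact mul_div_mul_left _ _ ha
        · have hnS : (chartAt (ℂ × ℂ) s).symm (down A (chartAt (ℂ × ℂ) s s) w) ∉ S := by
            intro hmem
            have hne : (chartAt (ℂ × ℂ) s).symm (down A (chartAt (ℂ × ℂ) s s) w) ≠ s := by
              intro heq
              have := (chartAt (ℂ × ℂ) s).right_inv hw1
              rw [heq] at this
              exact hw0 (down_eq_self.1 this.symm)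
            exact hw2 (by simpa [hne] using hmem)
          have hcalc : A' (chartAt (ℂ × ℂ) s ((chartAt (ℂ × ℂ) s).symm
              (down A (chartAt (ℂ × ℂ) s s) w)) - chartAt (ℂ × ℂ) s s) =
              w.1 • A' (A.symm (1, w.2)) := by
            rw [(chartAt (ℂ × ℂ) s).right_inv hw1, down, add_sub_cancel_left, ← map_smul,
              ← map_smul]
            simp
          refine ⟨⟨hw1, fun _ => hnS⟩, ?_⟩
          rw [e1 w ⟨hw0, hnS⟩]
          refine ⟨⟨(chartAt (ℂ × ℂ) s).map_target hw1, ?_⟩, ?_⟩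
          · rw [hcalc]
            exact mul_ne_zero hw0 hw3
          · refine Prod.ext ?_ ?_
            · simp only [dirChart, hcalc]
              rfl
            · simp only [dirChart, hcalc, Prod.smul_fst, Prod.smul_snd, smul_eq_mul]
              exact mul_div_mul_left _ _ hw0

/-- The topology of the blow-up of a complex surface, glued from its charts. -/
instance [IsManifold 𝓘(ℂ, ℂ × ℂ) ω M] : TopologicalSpace (Blowup S) :=
  (surfaceAtlas S).toCore.toTopologicalSpace

instance [IsManifold 𝓘(ℂ, ℂ × ℂ) ω M] : ChartedSpace (ℂ × ℂ) (Blowup S) :=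
  (surfaceAtlas S).toCore.toChartedSpace

/-- The blow-up of a complex surface is a complex surface. -/
instance [IsManifold 𝓘(ℂ, ℂ × ℂ) ω M] : IsManifold 𝓘(ℂ, ℂ × ℂ) ω (Blowup S) :=
  (surfaceAtlas S).isManifold

end Blowup

/-! ### Rational self-maps of the plane and the maps they induce on blow-ups -/

/-- The rational map of the plane with homogeneous components `G` is defined at `P` by
homogeneous coordinates, and takes the value `Q` there. -/
def RatMapsTo (G : (Fin 3 → ℂ) → (Fin 3 → ℂ)) (P Q : P2) : Prop :=
  ∃ (v : Fin 3 → ℂ) (hv : v ≠ 0) (hw : G v ≠ 0),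
    Projectivization.mk ℂ v hv = P ∧ Projectivization.mk ℂ (G v) hw = Q

section Induced

variable {X : Type*} (ρ : X → P2) (G : (Fin 3 → ℂ) → (Fin 3 → ℂ))

/-- `x` is the only point of `X` over its image in the plane. For a composition `ρ` of blow-downs
this says that `x` is not on one of the fibres over the blown-up points. -/
def IsGeneric (x : X) : Prop := ∀ x', ρ x' = ρ x → x' = x

/-- The graph of the rational map over the part of `X` which is identified with part of the plane:
both `x` and `y` are off the exceptional fibres of `ρ` and the rational map takes `ρ x` to `ρ y`. -/
def GenericGraph (x y : X) : Prop := IsGeneric ρ x ∧ IsGeneric ρ y ∧ RatMapsTo G (ρ x) (ρ y)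

variable [TopologicalSpace X]

/-- The induced map of `X` is defined at `x` and takes the value `y` there: `y` is the limit of `y'`
as `(x', y')` runs through the generic graph and `x'` tends to `x`. -/
def InducedMapsTo (x y : X) : Prop :=
  ∀ U ∈ 𝓝 y, ∀ᶠ x' in 𝓝 x, ∀ y', GenericGraph ρ G x' y' → y' ∈ U

/-- The union of the exceptional curves of the induced map, i.e. the curves which it maps to points:
it consists of the points where the map is defined and which are not isolated in their
fibre. -/
def exceptionalLocus : Set X :=
  {x | ∃ y, InducedMapsTo ρ G x y ∧ AccPt x (Filter.principal {x' | InducedMapsTo ρ G x' y})}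

/-- The strict transform of a subset of the plane. -/
def strictTransform (Γ : Set P2) : Set X := closure {x | IsGeneric ρ x ∧ ρ x ∈ Γ}

end Induced

/-- The line `c₀ x₀ + c₁ x₁ + c₂ x₂ = 0`. -/
def projLine (c : Fin 3 → ℂ) : Set P2 := {P | c ⬝ᵥ P.rep = 0}

/-- `P` has homogeneous coordinates `v`. -/
def HasCoords (P : P2) (v : Fin 3 → ℂ) : Prop := ∃ hv : v ≠ 0, Projectivization.mk ℂ v hv = P

/-! ### Linear fractional recurrences -/

namespace LinFrac

/-- The rational map
`[x₀ : x₁ : x₂] ↦ [x₀ (β ⬝ x) : x₂ (β ⬝ x) : x₀ (α ⬝ x)]`. -/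
def recMap (α β : Fin 3 → ℂ) (x : Fin 3 → ℂ) : Fin 3 → ℂ :=
  ![x 0 * (β ⬝ᵥ x), x 2 * (β ⬝ᵥ x), x 0 * (α ⬝ᵥ x)]

/-- The inverse rational map
`[x₀ : x₁ : x₂] ↦ [x₀ (B ⬝ x) : x₀ (A ⬝ x) - β₂ x₁ x₂ : x₁ (B ⬝ x)]`, where `A = (α₀, α₂, -β₀)`
and `B = (-α₁, 0, β₁)`. -/
def invMap (α β : Fin 3 → ℂ) (x : Fin 3 → ℂ) : Fin 3 → ℂ :=
  ![x 0 * (![-α 1, 0, β 1] ⬝ᵥ x), x 0 * (![α 0, α 2, -β 0] ⬝ᵥ x) - β 2 * x 1 * x 2,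
    x 1 * (![-α 1, 0, β 1] ⬝ᵥ x)]

/-- `recMap` and `invMap` are inverse to each other as rational maps. -/
theorem invMap_recMap (α β x : Fin 3 → ℂ) :
    invMap α β (recMap α β x) =
      (x 0 * (β ⬝ᵥ x) * (β 1 * (α ⬝ᵥ x) - α 1 * (β ⬝ᵥ x))) • x := by
  ext i
  fin_cases i <;> simp [invMap, recMap, dotProduct, Fin.sum_univ_three] <;> ring

/-- The standing assumptions on the parameters: `α` is not a multiple of `β`, and
`(α₁, β₁)`, `(α₂, β₂)` and `(β₁, β₂)` are all different from `(0, 0)`. -/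
structure Admissible (α β : Fin 3 → ℂ) : Prop where
  not_multiple : ¬ ∃ c : ℂ, α = c • β
  ne_one : (α 1, β 1) ≠ (0, 0)
  ne_two : (α 2, β 2) ≠ (0, 0)
  beta_ne : (β 1, β 2) ≠ (0, 0)

/-- Homogeneous coordinates of the point `p`. -/
def pVec (α β : Fin 3 → ℂ) : Fin 3 → ℂ :=
  ![β 1 * α 2 - β 2 * α 1, -β 0 * α 2 + α 0 * β 2, α 1 * β 0 - α 0 * β 1]

/-- Homogeneous coordinates of the point `q`. -/
def qVec (α β : Fin 3 → ℂ) : Fin 3 → ℂ :=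
  ![β 1 * (β 1 * α 2), β 1 * (α 1 * β 0 - α 0 * β 1), α 1 * (β 1 * α 2 - α 1 * β 2)]

/-- Coefficients of the line which `f` maps to `q`. -/
def gammaVec (α β : Fin 3 → ℂ) : Fin 3 → ℂ :=
  ![β 1 * α 0 - α 1 * β 0, 0, β 1 * α 2 - α 1 * β 2]

/-- Coefficients of the line which the inverse of `f` maps to `p`. -/
def cVec (α β : Fin 3 → ℂ) : Fin 3 → ℂ :=
  ![α 1 * β 0 - α 0 * β 1, α 1 * β 2 - α 2 * β 1, 0]

/-- The point `e₁ = [0 : 1 : 0]`. -/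
def eOne : P2 := Projectivization.mk ℂ ![0, 1, 0] (fun h => by simpa using congrFun h 1)

/-- The point `e₂ = [0 : 0 : 1]`. -/
def eTwo : P2 := Projectivization.mk ℂ ![0, 0, 1] (fun h => by simpa using congrFun h 2)

open Classical in
/-- The blow-up of the plane at `e₁` and `e₂`. -/
abbrev Y : Type := Blowup ({eOne, eTwo} : Finset P2)

/-- The projection of `Y` to the plane. -/
def projY : Y → P2 := Blowup.proj

/-- `o` is the orbit `q, f q, ..., f ^ n q` of `q`, it is defined up to time `n`, and `f ^ n q = p`.
Here `f` is the map induced on `Y`, which agrees with `f` on the plane off `e₁`, `e₂` and the lines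
`x₀ = 0` and `β ⬝ x = 0`, but is also defined along these lines when `β₂ = 0` (except at `p`).
The points `q` and `p` are not among `e₁`, `e₂`, so that they are points of `Y`. -/
structure IsOrbit (α β : Fin 3 → ℂ) {n : ℕ} (o : Fin (n + 1) → Y) : Prop where
  start : HasCoords (projY (o 0)) (qVec α β)
  step : ∀ j : Fin n, InducedMapsTo projY (recMap α β) (o j.castSucc) (o j.succ)
  finish : HasCoords (projY (o (Fin.last n))) (pVec α β)

/-- The variety of parameters `(α, β)` with `β₂ = 0` and `f ^ n q = p`. -/
def V (n : ℕ) : Set ((Fin 3 → ℂ) × (Fin 3 → ℂ)) :=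
  {P | P.2 2 = 0 ∧ ∃ o : Fin (n + 1) → Y, IsOrbit P.1 P.2 o}

open Classical in
/-- The blow-up of `Y` at the points of an orbit. -/
abbrev X {n : ℕ} (o : Fin (n + 1) → Y) : Type := Blowup (Finset.univ.image o)

/-- The projection of `X` to the plane. -/
def projX {n : ℕ} (o : Fin (n + 1) → Y) (x : X o) : P2 := projY x.proj

end LinFrac

end

open LinFrac

/-! ### Analytic preliminaries -/

section Hadamard

variable {E F : Type*} [NormedAddCommGroup E] [NormedSpace ℂ E]
  [NormedAddCommGroup F] [NormedSpace ℂ F]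

/-! When `β₂ = 0`, admissibility makes `α₂` and `β₁` nonzero, and in affine coordinates `f` is `(x,
y) ↦ (y, r + κ (y - c) / (x - b))` with `κ ≠ 0`, `p = (b, c)` and `q = (c, r)`. Exchanging `x` with
`y` and `b` with `r` gives the inverse map, so whatever is proved for all `Params` covers both
directions.

On `Y` everything is explicit. The line `x = b` goes to the exceptional curve over `e₂`, this one to
the line at infinity, this one to the exceptional curve over `e₁`, and this one to the line `y = r`.
Hence the induced map is holomorphic off `p` (`Params.exists_germ`). At `p` there is no limit
(`Params.not_limTo_p`). The fibre over `q` is the curve `y = c` without `p` (`Params.limTo_q_iff`),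
and away from `q` the inverse map inverts (`Params.limTo_inv`).

A holomorphic map `φ` lifts to the blow-up of a point `s` wherever, in a chart, `φ = s + h • w` with
`h`, `w` holomorphic and `w` nowhere zero (`Principal`, `Blowup.exists_lift_of_principal`). By
Hadamard's lemma this form survives composition with local biholomorphisms (`Principal.comp`). Three
places need it: along the contracted curve, `f = q + (y - c) • (1, κ / (x - b))`; over a point of
the orbit other than `p`, `f` is a local biholomorphism to the next point; over `p`, where `(x - b,
y - c) = h • (w₁, w₂)`, the image is `(c + h w₂, r + κ w₂ / w₁)`. For `h = 0` it lies on the closure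
of the line `x = c`, which meets the orbit only in `q`; near the direction `w₂ = 0` which is sent to
`q`, it is `q + w₂ • (h, κ / w₁)`.

So both lifted relations have holomorphic germs everywhere (`IsChain.exists_germ`). These are
inverse to each other on a dense set, hence everywhere, and a bijection has no exceptional curve.
Since induced maps are defined as limits of graphs, density of the graphs and the Hausdorff property
enter throughout, to make values unique. -/

theorem FormalMultilinearSeries.unshift_shift_eq_self (p : FormalMultilinearSeries ℂ E F) (z : F)
    (hz : ∀ v, p 0 v = z) : p.shift.unshift z = p := by
  ext n v
  cases n with
  | zero => exact (hz v).symm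
  | succ n =>
    exact congrFun (congrArg DFunLike.coe
      ((continuousMultilinearCurryRightEquiv' ℂ n E F).symm_apply_apply (p (n + 1)))) v

variable [CompleteSpace F]

/-- Hadamard's lemma for analytic maps. -/
theorem AnalyticAt.exists_eq_add_clm_apply_sub {f : E → F} {x : E} (hf : AnalyticAt ℂ f x) :
    ∃ L : E → E →L[ℂ] F, AnalyticAt ℂ L x ∧ ∀ᶠ y in 𝓝 x, f y = f x + L y (y - x) := by
  obtain ⟨p, r, hp⟩ := hf
  have hr : 0 < p.shift.radius := by
    rw [FormalMultilinearSeries.radius_shift]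
    exact hp.r_pos.trans_le hp.r_le
  -- `L` is the sum of the shifted series, which takes values in linear maps; unshifting applies it
  -- to `y - x` and restores the constant term.
  have hL := (p.shift.hasFPowerSeriesOnBall hr).comp_sub x
  rw [zero_add] at hL
  have hu := hL.unshift (z := f x)
  rw [p.unshift_shift_eq_self (f x) fun v => hp.coeff_zero v] at hu
  refine ⟨_, hL.analyticAt, ?_⟩
  have hpos : 0 < min r p.shift.radius := lt_min hp.r_pos hr
  filter_upwards [Metric.eball_mem_nhds x hpos] with y hy
  exact (hp.mono hpos (min_le_left _ _)).unique (hu.mono hpos (min_le_right _ _)) hy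

/-- If the analytic map is moreover left invertible, the linear factor is injective. -/
theorem AnalyticAt.exists_eq_add_clm_apply_sub_of_leftInverse {f : E → F} {g : F → E} {x : E}
    (hf : AnalyticAt ℂ f x) (hg : DifferentiableAt ℂ g (f x)) (hgf : ∀ᶠ y in 𝓝 x, g (f y) = y) :
    ∃ L : E → E →L[ℂ] F, AnalyticAt ℂ L x ∧ (∀ᶠ y in 𝓝 x, f y = f x + L y (y - x)) ∧
      ∀ w, w ≠ 0 → L x w ≠ 0 := by
  obtain ⟨L, hL, h⟩ := hf.exists_eq_add_clm_apply_sub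
  refine ⟨L, hL, h, fun w hw h0 => hw ?_⟩
  -- At `y = x` the product rule leaves only `L x`, so `L x` is the derivative of `f`, and the chain
  -- rule makes it left invertible.
  have hd : HasFDerivAt f (L x) x := by
    have h1 := (hL.differentiableAt.hasFDerivAt.clm_apply
      ((hasFDerivAt_id x).sub_const x)).const_add (f x)
    refine (h1.congr_of_eventuallyEq h).congr_fderiv ?_
    ext v
    simp
  have hid : HasFDerivAt (fun y => y) ((fderiv ℂ g (f x)).comp (L x)) x :=
    (hg.hasFDerivAt.comp x hd).congr_of_eventuallyEq
      (by filter_upwards [hgf] with y hy using hy.symm)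
  have := congrArg (fun T : E →L[ℂ] E => T w) (hid.unique (hasFDerivAt_id x))
  simpa [h0] using this.symm

end Hadamard

/-- A map between complex surfaces is holomorphic near a point. -/
abbrev HolAt {M N : Type*} [TopologicalSpace M] [ChartedSpace (ℂ × ℂ) M] [TopologicalSpace N]
    [ChartedSpace (ℂ × ℂ) N] (f : M → N) (x : M) : Prop :=
  ContMDiffAt 𝓘(ℂ, ℂ × ℂ) 𝓘(ℂ, ℂ × ℂ) ω f x

/-! ### Pulling back a point to a principal ideal -/

section Principal

variable {M M' N : Type*} [TopologicalSpace M] [ChartedSpace (ℂ × ℂ) M]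
  [TopologicalSpace M'] [ChartedSpace (ℂ × ℂ) M'] [TopologicalSpace N] [ChartedSpace (ℂ × ℂ) N]

/-- In the chart `ψ`, the map `φ` is near `ν` of the form `φ ν + h • w` with a holomorphic function
`h` and a nowhere vanishing holomorphic vector `w`: the ideal of the point `φ ν` pulls back to a
principal ideal. -/
def Principal (ψ : OpenPartialHomeomorph M (ℂ × ℂ)) (φ : N → M) (ν : N) : Prop :=
  ∃ (h : N → ℂ) (w : N → ℂ × ℂ), ContMDiffAt 𝓘(ℂ, ℂ × ℂ) 𝓘(ℂ, ℂ) ω h ν ∧ HolAt w ν ∧ w ν ≠ 0 ∧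
    ∀ᶠ ν' in 𝓝 ν, ψ (φ ν') = ψ (φ ν) + h ν' • w ν'

/-- Composition with a local biholomorphism preserves principality. -/
theorem Principal.comp {ψ : OpenPartialHomeomorph M (ℂ × ℂ)} {φ : N → M} {ν : N}
    (hP : Principal ψ φ ν) (hψ : ψ ∈ IsManifold.maximalAtlas 𝓘(ℂ, ℂ × ℂ) ω M)
    (hφ : ContinuousAt φ ν) (hν : φ ν ∈ ψ.source)
    {ψ' : OpenPartialHomeomorph M' (ℂ × ℂ)}
    (hψ' : ψ' ∈ IsManifold.maximalAtlas 𝓘(ℂ, ℂ × ℂ) ω M')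
    {g : M → M'} {g' : M' → M} (hg : HolAt g (φ ν)) (hg' : HolAt g' (g (φ ν)))
    (hgν : g (φ ν) ∈ ψ'.source) (hinv : ∀ᶠ x in 𝓝 (φ ν), g' (g x) = x) :
    Principal ψ' (fun ν' => g (φ ν')) ν := by
  obtain ⟨h, w, hh, hw, hw0, he⟩ := hP
  have hz : ψ (φ ν) ∈ ψ.target := ψ.map_source hν
  have hz' : ψ' (g (φ ν)) ∈ ψ'.target := ψ'.map_source hgν
  have hs : ψ.symm (ψ (φ ν)) = φ ν := ψ.left_inv hν
  have hs' : ψ'.symm (ψ' (g (φ ν))) = g (φ ν) := ψ'.left_inv hgν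
  have hψs := contMDiffAt_symm_of_mem_maximalAtlas hψ hz
  have hψs' := contMDiffAt_symm_of_mem_maximalAtlas hψ' hz'
  have h1 : HolAt (fun z => ψ' (g (ψ.symm z))) (ψ (φ ν)) := by
    have hgs : HolAt (fun z => g (ψ.symm z)) (ψ (φ ν)) :=
      ContMDiffAt.comp _ (by rwa [hs]) hψs
    refine ContMDiffAt.comp (g := ψ') (f := fun z => g (ψ.symm z)) _ ?_ hgs
    rw [hs]
    exact contMDiffAt_of_mem_maximalAtlas hψ' hgν
  have hinv0 : g' (g (φ ν)) = φ ν := hinv.self_of_nhds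
  have h2 : HolAt (fun z => ψ (g' (ψ'.symm z))) (ψ' (g (φ ν))) := by
    have hgs : HolAt (fun z => g' (ψ'.symm z)) (ψ' (g (φ ν))) :=
      ContMDiffAt.comp _ (by rwa [hs']) hψs'
    refine ContMDiffAt.comp (g := ψ) (f := fun z => g' (ψ'.symm z)) _ ?_ hgs
    rw [hs', hinv0]
    exact contMDiffAt_of_mem_maximalAtlas hψ hν
  -- Hadamard's lemma for the coordinate expression of `g`; the coordinate expression of `g'` is the
  -- left inverse which makes `L` injective at the point.
  obtain ⟨L, hL, hLe, hL0⟩ :=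
    (contMDiffAt_iff_contDiffAt.1 h1).analyticAt.exists_eq_add_clm_apply_sub_of_leftInverse
      (g := fun z => ψ (g' (ψ'.symm z)))
      (by
        rw [hs]
        exact (contMDiffAt_iff_contDiffAt.1 h2).differentiableAt (by simp))
      (by
        have hc : Filter.Tendsto ψ.symm (𝓝 (ψ (φ ν))) (𝓝 (φ ν)) := by
          have := ψ.continuousAt_symm hz
          rwa [ContinuousAt, hs] at this
        have hc' : ContinuousAt (fun z => g (ψ.symm z)) (ψ (φ ν)) :=
          ContinuousAt.comp (by rw [hs]; exact hg.continuousAt) hψs.continuousAt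
        filter_upwards [hc.eventually hinv, ψ.open_target.mem_nhds hz,
          hc'.eventually (ψ'.open_source.mem_nhds (by simpa only [hs] using hgν))] with z h1 h2 h3
        rw [ψ'.left_inv h3, h1, ψ.right_inv h2])
  have hψφ : HolAt (fun ν' => ψ (φ ν) + h ν' • w ν') ν := contMDiffAt_const.add (hh.smul hw)
  have h0 : h ν • w ν = 0 := by simpa using he.self_of_nhds.symm
  have hψφ0 : ψ (φ ν) + h ν • w ν = ψ (φ ν) := by rw [h0, add_zero]
  have hL1 : ContMDiffAt 𝓘(ℂ, ℂ × ℂ) 𝓘(ℂ, (ℂ × ℂ) →L[ℂ] (ℂ × ℂ)) ω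
      (fun ν' => L (ψ (φ ν) + h ν' • w ν')) ν :=
    ContMDiffAt.comp (g := L) ν (by rw [hψφ0]; exact hL.contDiffAt.contMDiffAt) hψφ
  -- By linearity `L (h • w) = h • L w`: the generator `h` of the ideal is unchanged.
  refine ⟨h, fun ν' => L (ψ (φ ν) + h ν' • w ν') (w ν'), hh, hL1.clm_apply hw, ?_, ?_⟩
  · dsimp only
    rw [hψφ0]
    exact hL0 _ hw0
  · have hc : Filter.Tendsto (fun ν' => ψ (φ ν) + h ν' • w ν') (𝓝 ν) (𝓝 (ψ (φ ν))) := by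
      have := hψφ.continuousAt
      rwa [ContinuousAt, hψφ0] at this
    filter_upwards [he, hφ.eventually (ψ.open_source.mem_nhds hν), hc.eventually hLe]
      with ν' h1 h2 h3
    rw [← h1, ψ.left_inv h2, hs, h1, add_sub_cancel_left, map_smul] at h3
    exact h3

end Principal

/-! ### Geometry of blow-ups -/

namespace SurfaceAtlas

/-- The charts of a surface atlas, as open partial homeomorphisms. -/
theorem mem_maximalAtlas {X : Type*} (c : SurfaceAtlas X) {e : PartialEquiv X (ℂ × ℂ)}
    (he : e ∈ c.atlas) :
    @Membership.mem _ _ _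
      (@IsManifold.maximalAtlas ℂ _ (ℂ × ℂ) _ _ (ℂ × ℂ) _ 𝓘(ℂ, ℂ × ℂ) ω X
        c.toCore.toTopologicalSpace c.toCore.toChartedSpace)
      (c.toCore.openPartialHomeomorph e he) := by
  let : TopologicalSpace X := c.toCore.toTopologicalSpace
  let : ChartedSpace (ℂ × ℂ) X := c.toCore.toChartedSpace
  have : IsManifold 𝓘(ℂ, ℂ × ℂ) ω X := c.isManifold
  refine IsManifold.subset_maximalAtlas ?_
  exact Set.mem_iUnion.2 ⟨e, Set.mem_iUnion.2 ⟨he, rfl⟩⟩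

end SurfaceAtlas

namespace Blowup

theorem pt_proj {M : Type*} {S : Finset M} {b : Blowup S} (hb : b.proj ∉ S) : pt b.proj hb = b := by
  cases b with
  | pt y hy => rfl
  | dir s hs v => exact absurd hs hb

theorem eq_of_proj_eq {M : Type*} {S : Finset M} {b b' : Blowup S} (hb : b.proj ∉ S)
    (h : b'.proj = b.proj) : b' = b := by
  rw [← pt_proj hb, ← pt_proj (b := b') (h ▸ hb)]
  congr 1

variable {M N : Type*} [TopologicalSpace M] [ChartedSpace (ℂ × ℂ) M]
  [IsManifold 𝓘(ℂ, ℂ × ℂ) ω M] [TopologicalSpace N] [ChartedSpace (ℂ × ℂ) N] {S : Finset M}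

variable (S) in
/-- The chart `ptChart` as an open partial homeomorphism. -/
noncomputable def ptHomeo (x : M) (hx : x ∉ S) : OpenPartialHomeomorph (Blowup S) (ℂ × ℂ) :=
  (surfaceAtlas S).toCore.openPartialHomeomorph (ptChart S x hx) (Or.inl ⟨x, hx, rfl⟩)

variable (S) in
/-- The chart `dirChart` as an open partial homeomorphism. -/
noncomputable def dirHomeo (s : M) (hs : s ∈ S) (A : (ℂ × ℂ) ≃L[ℂ] ℂ × ℂ) :
    OpenPartialHomeomorph (Blowup S) (ℂ × ℂ) :=
  (surfaceAtlas S).toCore.openPartialHomeomorph (dirChart S s hs A) (Or.inr ⟨s, hs, A, rfl⟩)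

theorem ptHomeo_mem (x : M) (hx : x ∉ S) :
    ptHomeo S x hx ∈ IsManifold.maximalAtlas 𝓘(ℂ, ℂ × ℂ) ω (Blowup S) :=
  (surfaceAtlas S).mem_maximalAtlas (Or.inl ⟨x, hx, rfl⟩)

theorem dirHomeo_mem (s : M) (hs : s ∈ S) (A : (ℂ × ℂ) ≃L[ℂ] ℂ × ℂ) :
    dirHomeo S s hs A ∈ IsManifold.maximalAtlas 𝓘(ℂ, ℂ × ℂ) ω (Blowup S) :=
  (surfaceAtlas S).mem_maximalAtlas (Or.inr ⟨s, hs, A, rfl⟩)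

/-- In coordinates the blow-down is the polynomial map `down`, on the exceptional curve as well as
off it; its holomorphy and its principal form are both read off from this. -/
theorem down_dirHomeo {s : M} {hs : s ∈ S} {A : (ℂ × ℂ) ≃L[ℂ] ℂ × ℂ} {b : Blowup S}
    (hb : b ∈ (dirHomeo S s hs A).source) :
    b.proj ∈ (chartAt (ℂ × ℂ) s).source ∧
      down A (chartAt (ℂ × ℂ) s s) (dirHomeo S s hs A b) = chartAt (ℂ × ℂ) s b.proj := by
  cases b with
  | pt x hx =>
    obtain ⟨h1, h2⟩ := hb
    refine ⟨h1, ?_⟩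
    change down A _ ((A (chartAt (ℂ × ℂ) s x - chartAt (ℂ × ℂ) s s)).1,
          (A (chartAt (ℂ × ℂ) s x - chartAt (ℂ × ℂ) s s)).2 /
          (A (chartAt (ℂ × ℂ) s x - chartAt (ℂ × ℂ) s s)).1) = chartAt (ℂ × ℂ) s x
    unfold down
    simp only [mul_div_cancel₀ _ h2, Prod.mk.eta, ContinuousLinearEquiv.symm_apply_apply]
    abel
  | dir t ht v =>
    obtain ⟨rfl, h2⟩ := hb
    exact ⟨mem_chart_source _ t, down_eq_self.2 rfl⟩

theorem proj_dirHomeo_symm {s : M} {hs : s ∈ S} {A : (ℂ × ℂ) ≃L[ℂ] ℂ × ℂ} {z : ℂ × ℂ}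
    (hz : z ∈ (dirHomeo S s hs A).target) :
    ((dirHomeo S s hs A).symm z).proj =
      (chartAt (ℂ × ℂ) s).symm (down A (chartAt (ℂ × ℂ) s s) z) := by
  obtain ⟨h1, h2⟩ := down_dirHomeo ((dirHomeo S s hs A).map_target hz)
  rw [(dirHomeo S s hs A).right_inv hz] at h2
  rw [h2, (chartAt (ℂ × ℂ) s).left_inv h1]

theorem exists_mem_dirHomeo_source (s : M) (hs : s ∈ S) (v : ℙ ℂ (ℂ × ℂ)) :
    ∃ A, dir s hs v ∈ (dirHomeo S s hs A).source := by
  by_cases h : v.rep.1 = 0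
  · exact ⟨ContinuousLinearEquiv.prodComm ℂ ℂ ℂ, rfl,
      fun h' => v.rep_nonzero (Prod.ext h h')⟩
  · exact ⟨ContinuousLinearEquiv.refl ℂ _, rfl, h⟩

/-- The blow-down map is holomorphic. -/
theorem holAt_proj (b : Blowup S) : HolAt (proj : Blowup S → M) b := by
  rcases b with ⟨y, hy⟩ | ⟨s, hs, v⟩
  · have hb : pt y hy ∈ (ptHomeo S y hy).source := ⟨hy, mem_chart_source _ y⟩
    have h1 := contMDiffAt_of_mem_maximalAtlas (ptHomeo_mem y hy) hb
    have h2 : HolAt (fun b => (chartAt (ℂ × ℂ) y).symm (ptHomeo S y hy b)) (pt y hy) :=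
      ContMDiffAt.comp (g := (chartAt (ℂ × ℂ) y).symm) _
        (contMDiffAt_symm_of_mem_maximalAtlas (IsManifold.chart_mem_maximalAtlas y)
          (mem_chart_target _ y)) h1
    refine h2.congr_of_eventuallyEq ?_
    filter_upwards [(ptHomeo S y hy).open_source.mem_nhds hb] with b hb
    exact ((chartAt (ℂ × ℂ) y).left_inv hb.2).symm
  · obtain ⟨A, hb⟩ := exists_mem_dirHomeo_source s hs v
    have h1 := contMDiffAt_of_mem_maximalAtlas (dirHomeo_mem s hs A) hb
    have h2 : HolAt (fun b => down A (chartAt (ℂ × ℂ) s s) (dirHomeo S s hs A b)) (dir s hs v) :=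
      ContMDiffAt.comp (g := down A (chartAt (ℂ × ℂ) s s)) _
        (down_contDiff _ _).contDiffAt.contMDiffAt h1
    have h3 : HolAt (fun b => (chartAt (ℂ × ℂ) s).symm
        (down A (chartAt (ℂ × ℂ) s s) (dirHomeo S s hs A b))) (dir s hs v) := by
      refine ContMDiffAt.comp (g := (chartAt (ℂ × ℂ) s).symm) _
        (contMDiffAt_symm_of_mem_maximalAtlas (IsManifold.chart_mem_maximalAtlas s) ?_) h2
      rw [(down_dirHomeo hb).2]
      exact (chartAt (ℂ × ℂ) s).map_source (down_dirHomeo hb).1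
    refine h3.congr_of_eventuallyEq ?_
    filter_upwards [(dirHomeo S s hs A).open_source.mem_nhds hb] with b hb
    rw [(down_dirHomeo hb).2, (chartAt (ℂ × ℂ) s).left_inv (down_dirHomeo hb).1]

theorem continuous_proj : Continuous (proj : Blowup S → M) :=
  continuous_iff_continuousAt.2 fun b => (holAt_proj b).continuousAt

/-- A holomorphic map which avoids the blown-up points lifts to the blow-up. -/
theorem exists_lift_of_notMem {φ : N → M} {ν : N} (hφ : HolAt φ ν) (hν : φ ν ∉ S) :
    ∃ Φ : N → Blowup S, HolAt Φ ν ∧ ∀ᶠ ν' in 𝓝 ν, (Φ ν').proj = φ ν' := by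
  have hz : chartAt (ℂ × ℂ) (φ ν) (φ ν) ∈ (ptHomeo S (φ ν) hν).target :=
    (ptHomeo S (φ ν) hν).map_source (x := pt (φ ν) hν) ⟨hν, mem_chart_source _ _⟩
  have h1 : HolAt (fun ν' => chartAt (ℂ × ℂ) (φ ν) (φ ν')) ν :=
    ContMDiffAt.comp (g := chartAt (ℂ × ℂ) (φ ν)) ν
      (contMDiffAt_of_mem_maximalAtlas (IsManifold.chart_mem_maximalAtlas _)
        (mem_chart_source _ _)) hφ
  refine ⟨fun ν' => (ptHomeo S (φ ν) hν).symm (chartAt (ℂ × ℂ) (φ ν) (φ ν')),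
    ContMDiffAt.comp (g := (ptHomeo S (φ ν) hν).symm) ν
      (contMDiffAt_symm_of_mem_maximalAtlas (ptHomeo_mem _ hν) hz) h1, ?_⟩
  filter_upwards [hφ.continuousAt.eventually ((chartAt (ℂ × ℂ) (φ ν)).open_source.mem_nhds
    (mem_chart_source _ _)), h1.continuousAt.eventually
      ((ptHomeo S (φ ν) hν).open_target.mem_nhds hz)] with ν' h1 h2
  have h3 : chartAt (ℂ × ℂ) (φ ν) ((ptHomeo S (φ ν) hν).symm
      (chartAt (ℂ × ℂ) (φ ν) (φ ν'))).proj = chartAt (ℂ × ℂ) (φ ν) (φ ν') :=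
    (ptHomeo S (φ ν) hν).right_inv h2
  exact (chartAt (ℂ × ℂ) (φ ν)).injOn ((ptHomeo S (φ ν) hν).map_target h2).2 h1 h3

/-- A map along which a blown-up point becomes principal lifts to the blow-up. -/
theorem exists_lift_of_principal {φ : N → M} {ν : N} (hφ : ContinuousAt φ ν) (hs : φ ν ∈ S)
    (hP : Principal (chartAt (ℂ × ℂ) (φ ν)) φ ν) :
    ∃ Φ : N → Blowup S, HolAt Φ ν ∧ ∀ᶠ ν' in 𝓝 ν, (Φ ν').proj = φ ν' := by
  obtain ⟨h, w, hh, hw, hw0, he⟩ := hP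
  set s := φ ν with hsdef
  have h0 : h ν = 0 := by
    have := he.self_of_nhds
    rw [← hsdef] at this
    simpa [hw0] using this
  -- The direction `w ν` must have finite slope in the chart of the blow-up; exchanging the
  -- coordinates if necessary ensures this.
  obtain ⟨A, hA⟩ : ∃ A : (ℂ × ℂ) ≃L[ℂ] ℂ × ℂ, (A (w ν)).1 ≠ 0 := by
    by_cases h1 : (w ν).1 = 0
    · exact ⟨ContinuousLinearEquiv.prodComm ℂ ℂ ℂ, fun h2 => hw0 (Prod.ext h1 h2)⟩
    · exact ⟨ContinuousLinearEquiv.refl ℂ _, h1⟩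
  have hAw : HolAt (fun ν' => A (w ν')) ν :=
    ContMDiffAt.comp (g := A) ν A.contDiff.contDiffAt.contMDiffAt hw
  have hAw1 : ContMDiffAt 𝓘(ℂ, ℂ × ℂ) 𝓘(ℂ, ℂ) ω (fun ν' => (A (w ν')).1) ν :=
    ContMDiffAt.comp (g := Prod.fst) (I' := 𝓘(ℂ, ℂ × ℂ)) ν
      contDiff_fst.contDiffAt.contMDiffAt hAw
  have hAw2 : ContMDiffAt 𝓘(ℂ, ℂ × ℂ) 𝓘(ℂ, ℂ) ω (fun ν' => (A (w ν')).2) ν :=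
    ContMDiffAt.comp (g := Prod.snd) (I' := 𝓘(ℂ, ℂ × ℂ)) ν
      contDiff_snd.contDiffAt.contMDiffAt hAw
  -- The factor `h` cancels in the slope of `h • w`, so the lift is holomorphic even where `h`
  -- vanishes.
  have hz : HolAt (fun ν' => (h ν' * (A (w ν')).1, (A (w ν')).2 / (A (w ν')).1)) ν :=
    (hh.mul hAw1).prodMk_space (hAw2.div₀ hAw1 hA)
  have ht : (h ν * (A (w ν)).1, (A (w ν)).2 / (A (w ν)).1) ∈ (dirHomeo S s hs A).target := by
    rw [h0, zero_mul]
    refine ⟨?_, fun h => absurd rfl h⟩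
    rw [down_eq_self.2 rfl]
    exact mem_chart_target _ s
  refine ⟨fun ν' => (dirHomeo S s hs A).symm (h ν' * (A (w ν')).1, (A (w ν')).2 / (A (w ν')).1),
    ContMDiffAt.comp (g := (dirHomeo S s hs A).symm) ν
      (contMDiffAt_symm_of_mem_maximalAtlas (dirHomeo_mem s hs A) ht) hz, ?_⟩
  filter_upwards [hφ.eventually ((chartAt (ℂ × ℂ) s).open_source.mem_nhds
    (mem_chart_source _ _)), hz.continuousAt.eventually
      ((dirHomeo S s hs A).open_target.mem_nhds ht), he,
      hAw1.continuousAt.eventually (isOpen_ne.mem_nhds hA)] with ν' h1 h2 h3 h4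
  rw [proj_dirHomeo_symm h2, down, mul_assoc, mul_div_cancel₀ _ h4,
    show (h ν' * (A (w ν')).1, h ν' * (A (w ν')).2) = h ν' • A (w ν') from rfl, map_smul,
    A.symm_apply_apply, ← h3, (chartAt (ℂ × ℂ) s).left_inv h1]

/-- Blown-up points become principal along the blow-down map. -/
theorem principal_proj (s : M) (hs : s ∈ S) (v : ℙ ℂ (ℂ × ℂ)) :
    Principal (chartAt (ℂ × ℂ) s) (proj : Blowup S → M) (dir s hs v) := by
  obtain ⟨A, hb⟩ := exists_mem_dirHomeo_source s hs v
  have h1 : HolAt (dirHomeo S s hs A) (dir s hs v) :=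
    contMDiffAt_of_mem_maximalAtlas (dirHomeo_mem s hs A) hb
  have hw : ContDiff ℂ ω (fun z : ℂ × ℂ => A.symm (1, z.2)) :=
    A.symm.contDiff.comp (contDiff_const.prodMk contDiff_snd)
  refine ⟨fun b => (dirHomeo S s hs A b).1, fun b => A.symm (1, (dirHomeo S s hs A b).2),
    ContMDiffAt.comp (g := Prod.fst) (I' := 𝓘(ℂ, ℂ × ℂ)) _ contDiff_fst.contDiffAt.contMDiffAt h1,
    ContMDiffAt.comp (g := fun z : ℂ × ℂ => A.symm (1, z.2)) _ hw.contDiffAt.contMDiffAt h1,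
    line_ne_zero _ _, ?_⟩
  filter_upwards [(dirHomeo S s hs A).open_source.mem_nhds hb] with b hb
  rw [← (down_dirHomeo hb).2, down, ← map_smul]
  simp [proj]

/-- Off the blown-up points the blow-down has a continuous local section, the lift of the identity,
along which accumulation can be transported upstairs. -/
theorem frequently_proj_mem {b : Blowup S} {D : Set M} (hD : ∃ᶠ y in 𝓝 b.proj, y ∈ D)
    (hb : b.proj ∉ S) : ∃ᶠ b' in 𝓝 b, b'.proj ∈ D ∧ b'.proj ∉ S := by
  obtain ⟨Φ, hΦ, hp⟩ := exists_lift_of_notMem (N := M) (φ := id) (ν := b.proj) contMDiffAt_id hb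
  have hb' : Φ b.proj = b := eq_of_proj_eq hb hp.self_of_nhds
  have hc := hΦ.continuousAt
  rw [ContinuousAt, hb'] at hc
  refine hc.frequently ?_
  have : T1Space M := ChartedSpace.t1Space (ℂ × ℂ) M
  have hS : ∀ᶠ y in 𝓝 b.proj, y ∉ S := S.finite_toSet.isClosed.isOpen_compl.mem_nhds hb
  refine (hD.and_eventually (hp.and hS)).mono fun y hy => ?_
  rw [hy.2.1]
  exact ⟨hy.1, hy.2.2⟩

/-- The preimage in the blow-up of a dense set is dense, even off the exceptional curves. -/
theorem dense_preimage {D : Set M} (hD : Dense D) :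
    Dense {b : Blowup S | b.proj ∈ D ∧ b.proj ∉ S} := by
  have h1 : ∀ b : Blowup S, b.proj ∉ S → b ∈ closure {b : Blowup S | b.proj ∈ D ∧ b.proj ∉ S} :=
    fun b hb => mem_closure_iff_frequently.2
      (frequently_proj_mem (mem_closure_iff_frequently.1 (hD b.proj)) hb)
  intro b
  by_cases hb : b.proj ∉ S
  · exact h1 b hb
  rcases b with ⟨y, hy⟩ | ⟨s, hs, v⟩
  · exact absurd hy hb
  -- A point of an exceptional curve is a limit of points off these curves, which are already known
  -- to lie in the closure.
  rw [← closure_closure]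
  refine closure_mono (s := {b : Blowup S | b.proj ∉ S}) (fun b hb => h1 b hb) ?_
  obtain ⟨A, hb⟩ := exists_mem_dirHomeo_source s hs v
  set e := dirHomeo S s hs A with he
  have hc := e.continuousAt_symm (e.map_source hb)
  rw [ContinuousAt, e.left_inv hb] at hc
  refine mem_closure_iff_frequently.2 (hc.frequently ?_)
  have hf : ∃ᶠ z : ℂ × ℂ in 𝓝 (e (dir s hs v)), z.1 ≠ 0 := by
    suffices Dense {z : ℂ × ℂ | z.1 ≠ 0} from mem_closure_iff_frequently.1 (this _)
    have : {z : ℂ × ℂ | z.1 ≠ 0} = {(0 : ℂ)}ᶜ ×ˢ Set.univ := by ext; simp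
    rw [this]
    exact (dense_compl_singleton 0).prod dense_univ
  refine (hf.and_eventually (e.open_target.mem_nhds (e.map_source hb))).mono fun z hz => ?_
  have := hz.2.2 hz.1
  rw [← proj_dirHomeo_symm hz.2] at this
  exact this

/-- If neither coordinate is nonzero on both vectors, then one vector lies on each axis, and the sum
of the coordinates is nonzero on both. This separates two directions at the same point. -/
theorem exists_common_chart (v v' : ℂ × ℂ) (hv : v ≠ 0) (hv' : v' ≠ 0) :
    ∃ A : (ℂ × ℂ) ≃L[ℂ] ℂ × ℂ, (A v).1 ≠ 0 ∧ (A v').1 ≠ 0 := by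
  by_cases h1 : v.1 ≠ 0 ∧ v'.1 ≠ 0
  · exact ⟨ContinuousLinearEquiv.refl ℂ _, h1⟩
  by_cases h2 : v.2 ≠ 0 ∧ v'.2 ≠ 0
  · exact ⟨ContinuousLinearEquiv.prodComm ℂ ℂ ℂ, h2⟩
  refine ⟨((ContinuousLinearEquiv.refl ℂ ℂ).skewProd (ContinuousLinearEquiv.refl ℂ ℂ)
    (ContinuousLinearMap.id ℂ ℂ)).trans (ContinuousLinearEquiv.prodComm ℂ ℂ ℂ), ?_⟩
  obtain ⟨x, y⟩ := v
  obtain ⟨x', y'⟩ := v'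
  simp only [ne_eq, Prod.mk_eq_zero] at hv hv' h1 h2
  constructor
  · change y + x ≠ 0
    by_cases hx : x = 0
    · simp_all
    · by_cases hy : y = 0
      · simp_all
      · simp_all
  · change y' + x' ≠ 0
    by_cases hx : x' = 0
    · simp_all
    · by_cases hy : y' = 0
      · simp_all
      · simp_all

instance [T2Space M] : T2Space (Blowup S) := by
  refine ⟨fun b b' hbb => ?_⟩
  by_cases hp : b.proj = b'.proj
  swap
  · obtain ⟨U, V, hU, hV, hb, hb', hUV⟩ := t2_separation hp
    exact ⟨_, _, hU.preimage continuous_proj, hV.preimage continuous_proj, hb, hb',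
      hUV.preimage _⟩
  · rcases b with ⟨y, hy⟩ | ⟨s, hs, v⟩
    · exact absurd (eq_of_proj_eq (b := pt y hy) hy hp.symm).symm hbb
    rcases b' with ⟨y, hy⟩ | ⟨s', hs', v'⟩
    · exact absurd (eq_of_proj_eq (b := pt y hy) hy hp) hbb
    obtain rfl : s = s' := hp
    obtain ⟨A, hA, hA'⟩ := exists_common_chart v.rep v'.rep v.rep_nonzero v'.rep_nonzero
    have h1 : dir s hs v ∈ (dirHomeo S s hs A).source := ⟨rfl, hA⟩
    have h2 : dir s hs v' ∈ (dirHomeo S s hs A).source := ⟨rfl, hA'⟩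
    have hne : dirHomeo S s hs A (dir s hs v) ≠ dirHomeo S s hs A (dir s hs v') :=
      fun h => hbb ((dirHomeo S s hs A).injOn h1 h2 h)
    obtain ⟨U, V, hU, hV, hb, hb', hUV⟩ := t2_separation hne
    exact ⟨_, _, (dirHomeo S s hs A).isOpen_inter_preimage hU,
      (dirHomeo S s hs A).isOpen_inter_preimage hV, ⟨h1, hb⟩, ⟨h2, hb'⟩,
      (hUV.preimage _).mono Set.inter_subset_right Set.inter_subset_right⟩

end Blowup

/-! ### Separation and charts of the projective plane -/

namespace P2

/-- The standard charts as open partial homeomorphisms. -/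
noncomputable def homeo (i : Fin 3) : OpenPartialHomeomorph P2 (ℂ × ℂ) :=
  surfaceAtlas.toCore.openPartialHomeomorph (chart i) ⟨i, rfl⟩

theorem affineVec_homeo {i : Fin 3} {P : P2} (hP : P.rep i ≠ 0) (k : Fin 3) :
    affineVec i (homeo i P) k = P.rep k / P.rep i := by
  have h1 : (homeo i P).1 = P.rep (i + 1) / P.rep i := rfl
  have h2 : (homeo i P).2 = P.rep (i + 2) / P.rep i := rfl
  unfold affineVec
  rw [h1, h2]
  fin_cases i <;> fin_cases k <;> simp_all

/-- The inequality does not depend on the scaling of the representative, so near a point it can be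
tested on the continuous vector `affineVec`. -/
theorem isOpen_norm_rep_lt (i j : Fin 3) : IsOpen {P : P2 | ‖P.rep i‖ < ‖P.rep j‖} := by
  refine isOpen_iff_mem_nhds.2 fun P hP => ?_
  obtain ⟨k, hk⟩ := Function.ne_iff.1 P.rep_nonzero
  have hk' : P ∈ (homeo k).source := hk
  have hc : ∀ l, ContinuousAt (fun Q => affineVec k (homeo k Q) l) P := fun l =>
    ContinuousAt.comp (g := fun z => affineVec k z l)
      (affineVec_contDiff k l).continuous.continuousAt
      ((homeo k).continuousAt hk')
  have key : ∀ Q : P2, Q.rep k ≠ 0 → (‖Q.rep i‖ < ‖Q.rep j‖ ↔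
      ‖affineVec k (homeo k Q) i‖ < ‖affineVec k (homeo k Q) j‖) := by
    intro Q hQ
    rw [affineVec_homeo hQ, affineVec_homeo hQ, norm_div, norm_div,
      div_lt_div_iff_of_pos_right (norm_pos_iff.2 hQ)]
  filter_upwards [(homeo k).open_source.mem_nhds hk',
    (hc i).norm.eventually_lt (hc j).norm ((key P hk).1 hP)] with Q hQ hlt
  exact (key Q hQ).2 hlt

instance : T2Space P2 := by
  refine ⟨fun P Q hPQ => ?_⟩
  obtain ⟨i, hi⟩ := Function.ne_iff.1 P.rep_nonzero
  obtain ⟨j, hj⟩ := Function.ne_iff.1 Q.rep_nonzero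
  by_cases hi' : Q.rep i = 0
  · by_cases hj' : P.rep j = 0
    -- Neither of the charts `i` and `j` contains both points; comparing the sizes of these two
    -- coordinates separates them.
    · refine ⟨_, _, isOpen_norm_rep_lt j i, isOpen_norm_rep_lt i j, ?_, ?_, ?_⟩
      · simpa [hj'] using hi
      · simpa [hi'] using hj
      · refine Set.disjoint_left.2 fun R h1 h2 => ?_
        exact lt_asymm (a := ‖R.rep i‖) (b := ‖R.rep j‖) h2 h1
    · have hne : homeo j P ≠ homeo j Q := fun h =>
        hPQ ((homeo j).injOn (show P.rep j ≠ 0 from hj') (show Q.rep j ≠ 0 from hj) h)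
      obtain ⟨U, V, hU, hV, hb, hb', hUV⟩ := t2_separation hne
      exact ⟨_, _, (homeo j).isOpen_inter_preimage hU, (homeo j).isOpen_inter_preimage hV,
        ⟨hj', hb⟩, ⟨hj, hb'⟩, (hUV.preimage _).mono Set.inter_subset_right Set.inter_subset_right⟩
  · have hne : homeo i P ≠ homeo i Q := fun h =>
      hPQ ((homeo i).injOn (show P.rep i ≠ 0 from hi) (show Q.rep i ≠ 0 from hi') h)
    obtain ⟨U, V, hU, hV, hb, hb', hUV⟩ := t2_separation hne
    exact ⟨_, _, (homeo i).isOpen_inter_preimage hU, (homeo i).isOpen_inter_preimage hV,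
      ⟨hi, hb⟩, ⟨hi', hb'⟩, (hUV.preimage _).mono Set.inter_subset_right Set.inter_subset_right⟩

/-- The preferred chart is picked by choice among the nonvanishing coordinates, so it is known only
where there is exactly one of them. This holds at `e₁`, `e₂` and the origin, which suffices for `Y`.
-/
theorem chartAt_eq_homeo {P : P2} {i : Fin 3} (h : ∀ j, P.rep j ≠ 0 → j = i) :
    chartAt (ℂ × ℂ) P = homeo i := by
  have : Classical.choose (Function.ne_iff.1 P.rep_nonzero) = i :=
    h _ (Classical.choose_spec (Function.ne_iff.1 P.rep_nonzero))
  subst this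
  rfl

theorem chartAt_mk_single (i : Fin 3) {v : Fin 3 → ℂ} (hv : v ≠ 0) (h : ∀ j, v j ≠ 0 → j = i) :
    chartAt (ℂ × ℂ) (Projectivization.mk ℂ v hv) = homeo i := by
  refine chartAt_eq_homeo fun j hj => ?_
  obtain ⟨a, ha, hr⟩ := rep_mk_div v hv
  rw [hr] at hj
  exact h j (right_ne_zero_of_mul hj)

end P2

/-! ### Homogeneous coordinates -/

theorem HasCoords.smul_eq {P : P2} {v w : Fin 3 → ℂ} (hv : HasCoords P v) (hw : HasCoords P w) :
    ∃ t : ℂ, t ≠ 0 ∧ w = t • v := by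
  obtain ⟨h1, rfl⟩ := hv
  obtain ⟨h2, h⟩ := hw
  obtain ⟨a, ha⟩ := (Projectivization.mk_eq_mk_iff ℂ _ _ _ _).1 h
  exact ⟨a, a.ne_zero, ha.symm⟩

theorem HasCoords.smul {P : P2} {v : Fin 3 → ℂ} (hv : HasCoords P v) {t : ℂ} (ht : t ≠ 0) :
    HasCoords P (t • v) := by
  obtain ⟨h1, rfl⟩ := hv
  exact ⟨smul_ne_zero ht h1, (Projectivization.mk_eq_mk_iff' ℂ _ _ _ _).2 ⟨t, rfl⟩⟩

theorem HasCoords.eq {P Q : P2} {v : Fin 3 → ℂ} (hP : HasCoords P v) (hQ : HasCoords Q v) :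
    P = Q := by
  obtain ⟨_, rfl⟩ := hP
  obtain ⟨_, rfl⟩ := hQ
  rfl

theorem hasCoords_rep (P : P2) : HasCoords P P.rep := ⟨P.rep_nonzero, P.mk_rep⟩

namespace LinFrac

/-- The vector `(x₀, x₁, x₂)`, with the last two coordinates exchanged if `τ` is true. -/
def coords (τ : Bool) (x₀ x₁ x₂ : ℂ) : Fin 3 → ℂ := ![x₀, cond τ x₂ x₁, cond τ x₁ x₂]

theorem coords_not (τ : Bool) (x₀ x₁ x₂ : ℂ) : coords (!τ) x₀ x₁ x₂ = coords τ x₀ x₂ x₁ := by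
  cases τ <;> rfl

theorem smul_coords (τ : Bool) (t x₀ x₁ x₂ : ℂ) :
    t • coords τ x₀ x₁ x₂ = coords τ (t * x₀) (t * x₁) (t * x₂) := by
  cases τ <;> simp [coords]

theorem coords_inj {τ : Bool} {x₀ x₁ x₂ y₀ y₁ y₂ : ℂ} :
    coords τ x₀ x₁ x₂ = coords τ y₀ y₁ y₂ ↔ x₀ = y₀ ∧ x₁ = y₁ ∧ x₂ = y₂ := by
  cases τ <;> (simp [coords]; try tauto)

theorem exists_eq_coords (τ : Bool) (v : Fin 3 → ℂ) : ∃ x₀ x₁ x₂, v = coords τ x₀ x₁ x₂ := by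
  cases τ
  · exact ⟨v 0, v 1, v 2, by ext i; fin_cases i <;> rfl⟩
  · exact ⟨v 0, v 2, v 1, by ext i; fin_cases i <;> rfl⟩

theorem hasCoords_eOne : HasCoords eOne (coords false 0 1 0) := ⟨_, rfl⟩

theorem hasCoords_eTwo : HasCoords eTwo (coords false 0 0 1) := ⟨_, rfl⟩

theorem mem_base_of_coords {P : P2} {τ : Bool} {x₀ x₁ x₂ : ℂ}
    (hP : HasCoords P (coords τ x₀ x₁ x₂)) (h : P = eOne ∨ P = eTwo) :
    x₀ = 0 ∧ (x₁ = 0 ∨ x₂ = 0) := by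
  rcases h with rfl | rfl
  · obtain ⟨t, ht, h⟩ := hasCoords_eOne.smul_eq hP
    cases τ <;> simp [coords] at h <;> simp [h]
  · obtain ⟨t, ht, h⟩ := hasCoords_eTwo.smul_eq hP
    cases τ <;> simp [coords] at h <;> simp [h]

/-! ### Holomorphic parametrizations of the surface `Y` -/

/-- `a` is a holomorphic parametrization of an open set, with holomorphic inverse `a'`. -/
structure IsParam {M : Type*} [TopologicalSpace M] [ChartedSpace (ℂ × ℂ) M]
    (a : ℂ × ℂ → M) (a' : M → ℂ × ℂ) : Prop where
  hol : ∀ z, HolAt a z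
  hol_inv : ∀ z, HolAt a' (a z)
  left_inv : ∀ z, a' (a z) = z
  right_inv : ∀ z, ∀ᶠ y in 𝓝 (a z), a (a' y) = y

section IsParam

variable {M : Type*} [TopologicalSpace M] [ChartedSpace (ℂ × ℂ) M]

theorem IsParam.of_openPartialHomeomorph
    {e : OpenPartialHomeomorph M (ℂ × ℂ)} (he : e ∈ IsManifold.maximalAtlas 𝓘(ℂ, ℂ × ℂ) ω M)
    (ht : ∀ z, z ∈ e.target) : IsParam e.symm e where
  hol z := contMDiffAt_symm_of_mem_maximalAtlas he (ht z)
  hol_inv z := contMDiffAt_of_mem_maximalAtlas he (e.map_target (ht z))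
  left_inv z := e.right_inv (ht z)
  right_inv z := by
    filter_upwards [e.open_source.mem_nhds (e.map_target (ht z))] with y hy using e.left_inv hy

theorem IsParam.swap {a : ℂ × ℂ → M} {a' : M → ℂ × ℂ} (h : IsParam a a') :
    IsParam (fun z => a z.swap) (fun y => (a' y).swap) := by
  have hs : ContDiff ℂ ω (Prod.swap : ℂ × ℂ → ℂ × ℂ) := contDiff_snd.prodMk contDiff_fst
  exact
    { hol := fun z => ContMDiffAt.comp (g := a) z (h.hol _) hs.contDiffAt.contMDiffAt
      hol_inv := fun z => ContMDiffAt.comp (g := Prod.swap) _ hs.contDiffAt.contMDiffAt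
        (h.hol_inv z.swap)
      left_inv := fun z => by rw [h.left_inv, Prod.swap_swap]
      right_inv := fun z => by simpa using h.right_inv z.swap }

theorem IsParam.injective {a : ℂ × ℂ → M} {a' : M → ℂ × ℂ} (h : IsParam a a') :
    Function.Injective a := fun z z' hz => by rw [← h.left_inv z, hz, h.left_inv]

theorem IsParam.continuous {a : ℂ × ℂ → M} {a' : M → ℂ × ℂ} (h : IsParam a a') : Continuous a :=
  continuous_iff_continuousAt.2 fun z => (h.hol z).continuousAt

end IsParam

/-! ### Charts of `Y` in homogeneous coordinates -/

open Classical in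
theorem eOne_mem : eOne ∈ ({eOne, eTwo} : Finset P2) := by simp

open Classical in
theorem eTwo_mem : eTwo ∈ ({eOne, eTwo} : Finset P2) := by simp

open Classical in
theorem notMem_base {P : P2} {τ : Bool} {x₀ x₁ x₂ : ℂ}
    (hP : HasCoords P (coords τ x₀ x₁ x₂)) (h : x₀ ≠ 0 ∨ x₁ ≠ 0 ∧ x₂ ≠ 0) :
    P ∉ ({eOne, eTwo} : Finset P2) := by
  intro hm
  have := mem_base_of_coords hP (by simpa using hm)
  tauto

theorem affineVec_zero (z : ℂ × ℂ) : P2.affineVec 0 z = coords false 1 z.1 z.2 := by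
  ext i; fin_cases i <;> simp [P2.affineVec, coords]

theorem affineVec_one (z : ℂ × ℂ) : P2.affineVec 1 z = coords false z.2 1 z.1 := by
  ext i; fin_cases i <;> simp [P2.affineVec, coords]

theorem affineVec_two (z : ℂ × ℂ) : P2.affineVec 2 z = coords false z.1 z.2 1 := by
  ext i; fin_cases i <;> simp [P2.affineVec, coords]

theorem hasCoords_homeo_symm (i : Fin 3) (z : ℂ × ℂ) :
    HasCoords ((P2.homeo i).symm z) (P2.affineVec i z) := ⟨P2.affineVec_ne_zero i z, rfl⟩

/-- The origin of the affine plane. -/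
noncomputable def origin : P2 :=
  Projectivization.mk ℂ (coords false 1 0 0) fun h => by simpa [coords] using congrFun h 0

theorem hasCoords_origin : HasCoords origin (coords false 1 0 0) := ⟨_, rfl⟩

theorem chartAt_origin : chartAt (ℂ × ℂ) origin = P2.homeo 0 :=
  P2.chartAt_mk_single 0 _ fun j hj => by fin_cases j <;> simp_all [coords]

theorem chartAt_eOne : chartAt (ℂ × ℂ) eOne = P2.homeo 1 :=
  P2.chartAt_mk_single 1 _ fun j hj => by fin_cases j <;> simp_all

theorem chartAt_eTwo : chartAt (ℂ × ℂ) eTwo = P2.homeo 2 :=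
  P2.chartAt_mk_single 2 _ fun j hj => by fin_cases j <;> simp_all

theorem homeo_eOne : P2.homeo 1 eOne = 0 := by
  obtain ⟨a, ha, hr⟩ := P2.rep_mk_div ![0, 1, 0] (fun h => by simpa using congrFun h 1)
  refine Prod.ext ?_ ?_
  · change eOne.rep 2 / eOne.rep 1 = 0
    rw [eOne, hr]; simp
  · change eOne.rep 0 / eOne.rep 1 = 0
    rw [eOne, hr]; simp

theorem homeo_eTwo : P2.homeo 2 eTwo = 0 := by
  obtain ⟨a, ha, hr⟩ := P2.rep_mk_div ![0, 0, 1] (fun h => by simpa using congrFun h 2)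
  refine Prod.ext ?_ ?_
  · change eTwo.rep 0 / eTwo.rep 2 = 0
    rw [eTwo, hr]; simp
  · change eTwo.rep 1 / eTwo.rep 2 = 0
    rw [eTwo, hr]; simp

open Classical in
/-- The chart of `Y` on the affine plane. -/
noncomputable def affineChart : OpenPartialHomeomorph Y (ℂ × ℂ) :=
  Blowup.ptHomeo ({eOne, eTwo} : Finset P2) origin (notMem_base hasCoords_origin (by simp))

open Classical in
/-- The charts of `Y` near the exceptional curve over `e₁`. -/
noncomputable def chartOne (A : (ℂ × ℂ) ≃L[ℂ] ℂ × ℂ) : OpenPartialHomeomorph Y (ℂ × ℂ) :=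
  Blowup.dirHomeo ({eOne, eTwo} : Finset P2) eOne eOne_mem A

open Classical in
/-- The charts of `Y` near the exceptional curve over `e₂`. -/
noncomputable def chartTwo (A : (ℂ × ℂ) ≃L[ℂ] ℂ × ℂ) : OpenPartialHomeomorph Y (ℂ × ℂ) :=
  Blowup.dirHomeo ({eOne, eTwo} : Finset P2) eTwo eTwo_mem A

theorem mem_affineChart_target (z : ℂ × ℂ) : z ∈ affineChart.target := by
  refine ⟨?_, ?_⟩
  · rw [chartAt_origin]
    exact Set.mem_univ z
  · rw [chartAt_origin]
    exact notMem_base (affineVec_zero z ▸ hasCoords_homeo_symm 0 z) (by simp)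

-- For `z.1 ≠ 0` the point below has nonzero coordinates in the affine chart centred at `e₁`, so it
-- is not `e₁`, and `e₂` is not in this chart. Hence the inverse chart parametrizes by all of `ℂ ×
-- ℂ`; the same works at `e₂`.
open Classical in
theorem mem_chartOne_target (A : (ℂ × ℂ) ≃L[ℂ] ℂ × ℂ) (z : ℂ × ℂ) :
    z ∈ (chartOne A).target := by
  refine ⟨?_, fun hz => ?_⟩
  · rw [chartAt_eOne]
    exact Set.mem_univ _
  · rw [chartAt_eOne, homeo_eOne]
    have hd : Blowup.down A 0 z ≠ 0 := fun h => hz (Blowup.down_eq_self.1 h)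
    have hc := hasCoords_homeo_symm 1 (Blowup.down A 0 z)
    rw [affineVec_one] at hc
    intro hm
    rcases Finset.mem_insert.1 hm with hm | hm
    · rw [hm] at hc
      obtain ⟨t, ht, h⟩ := hc.smul_eq hasCoords_eOne
      rw [smul_coords, coords_inj] at h
      simp only [zero_eq_mul, ht, false_or] at h
      exact hd (Prod.ext h.2.2 h.1)
    · rw [Finset.mem_singleton.1 hm] at hc
      obtain ⟨t, ht, h⟩ := hc.smul_eq hasCoords_eTwo
      rw [smul_coords, coords_inj] at h
      simp [ht, ht.symm] at h

open Classical in
theorem mem_chartTwo_target (A : (ℂ × ℂ) ≃L[ℂ] ℂ × ℂ) (z : ℂ × ℂ) :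
    z ∈ (chartTwo A).target := by
  refine ⟨?_, fun hz => ?_⟩
  · rw [chartAt_eTwo]
    exact Set.mem_univ _
  · rw [chartAt_eTwo, homeo_eTwo]
    have hd : Blowup.down A 0 z ≠ 0 := fun h => hz (Blowup.down_eq_self.1 h)
    have hc := hasCoords_homeo_symm 2 (Blowup.down A 0 z)
    rw [affineVec_two] at hc
    intro hm
    rcases Finset.mem_insert.1 hm with hm | hm
    · rw [hm] at hc
      obtain ⟨t, ht, h⟩ := hc.smul_eq hasCoords_eOne
      rw [smul_coords, coords_inj] at h
      simp [ht, ht.symm] at h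
    · rw [Finset.mem_singleton.1 hm] at hc
      obtain ⟨t, ht, h⟩ := hc.smul_eq hasCoords_eTwo
      rw [smul_coords, coords_inj] at h
      simp only [zero_eq_mul, ht, false_or] at h
      exact hd (Prod.ext h.1 h.2.1)

theorem isParam_affineChart : IsParam affineChart.symm affineChart :=
  .of_openPartialHomeomorph (Blowup.ptHomeo_mem _ _) mem_affineChart_target

theorem isParam_chartOne (A : (ℂ × ℂ) ≃L[ℂ] ℂ × ℂ) : IsParam (chartOne A).symm (chartOne A) :=
  .of_openPartialHomeomorph (Blowup.dirHomeo_mem _ _ _) (mem_chartOne_target A)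

theorem isParam_chartTwo (A : (ℂ × ℂ) ≃L[ℂ] ℂ × ℂ) : IsParam (chartTwo A).symm (chartTwo A) :=
  .of_openPartialHomeomorph (Blowup.dirHomeo_mem _ _ _) (mem_chartTwo_target A)

theorem hasCoords_affineChart_symm (z : ℂ × ℂ) :
    HasCoords (projY (affineChart.symm z)) (coords false 1 z.1 z.2) := by
  have hm : affineChart.symm z ∈ affineChart.source :=
    affineChart.map_target (mem_affineChart_target z)
  have h2 : projY (affineChart.symm z) ∈ (chartAt (ℂ × ℂ) origin).source := hm.2
  have h1 : chartAt (ℂ × ℂ) origin (projY (affineChart.symm z)) = z :=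
    affineChart.right_inv (mem_affineChart_target z)
  have h3 := (chartAt (ℂ × ℂ) origin).left_inv h2
  rw [h1, chartAt_origin] at h3
  rw [← h3, ← affineVec_zero]
  exact hasCoords_homeo_symm 0 z

theorem hasCoords_chartOne_symm (A : (ℂ × ℂ) ≃L[ℂ] ℂ × ℂ) (z : ℂ × ℂ) :
    HasCoords (projY ((chartOne A).symm z))
      (coords false (A.symm (z.1, z.1 * z.2)).2 1 (A.symm (z.1, z.1 * z.2)).1) := by
  have h : projY ((chartOne A).symm z) = _ :=
    Blowup.proj_dirHomeo_symm (mem_chartOne_target A z)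
  rw [h, chartAt_eOne, homeo_eOne, Blowup.down, zero_add, ← affineVec_one]
  exact hasCoords_homeo_symm 1 _

theorem hasCoords_chartTwo_symm (A : (ℂ × ℂ) ≃L[ℂ] ℂ × ℂ) (z : ℂ × ℂ) :
    HasCoords (projY ((chartTwo A).symm z))
      (coords false (A.symm (z.1, z.1 * z.2)).1 (A.symm (z.1, z.1 * z.2)).2 1) := by
  have h : projY ((chartTwo A).symm z) = _ :=
    Blowup.proj_dirHomeo_symm (mem_chartTwo_target A z)
  rw [h, chartAt_eTwo, homeo_eTwo, Blowup.down, zero_add, ← affineVec_two]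
  exact hasCoords_homeo_symm 2 _

/-- The parametrization `(x, y) ↦ [1 : x : y]` of the affine plane. Here and below, `τ` tells
whether to exchange the coordinates `x` and `y`. -/
noncomputable def affine (τ : Bool) (z : ℂ × ℂ) : Y :=
  affineChart.symm (cond τ z.swap z)

/-- The parametrization of `Y` by `(1 / x, y)`, near `x = ∞`. -/
noncomputable def side (τ : Bool) : ℂ × ℂ → Y :=
  cond τ (chartTwo (.refl ℂ _)).symm (chartOne (.prodComm ℂ ℂ ℂ)).symm

/-- The parametrization of `Y` by `(y / x, 1 / y)`, near the line at infinity. -/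
noncomputable def corner (τ : Bool) : ℂ × ℂ → Y :=
  cond τ (chartTwo (.prodComm ℂ ℂ ℂ)).symm (chartOne (.refl ℂ _)).symm

theorem affine_not (τ : Bool) (z : ℂ × ℂ) : affine (!τ) z = affine τ z.swap := by
  cases τ <;> rfl

theorem isParam_affine (τ : Bool) : ∃ a', IsParam (affine τ) a' := by
  cases τ
  · exact ⟨_, isParam_affineChart⟩
  · exact ⟨_, isParam_affineChart.swap⟩

theorem isParam_side (τ : Bool) : ∃ a', IsParam (side τ) a' := by
  cases τ
  · exact ⟨_, isParam_chartOne _⟩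
  · exact ⟨_, isParam_chartTwo _⟩

theorem isParam_corner (τ : Bool) : ∃ a', IsParam (corner τ) a' := by
  cases τ
  · exact ⟨_, isParam_chartOne _⟩
  · exact ⟨_, isParam_chartTwo _⟩

theorem hasCoords_affine (τ : Bool) (z : ℂ × ℂ) :
    HasCoords (projY (affine τ z)) (coords τ 1 z.1 z.2) := by
  cases τ
  · exact hasCoords_affineChart_symm z
  · exact hasCoords_affineChart_symm z.swap

theorem hasCoords_side (τ : Bool) (z : ℂ × ℂ) :
    HasCoords (projY (side τ z)) (coords τ z.1 1 (z.1 * z.2)) := by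
  cases τ
  · exact hasCoords_chartOne_symm _ z
  · exact hasCoords_chartTwo_symm _ z

theorem hasCoords_corner (τ : Bool) (z : ℂ × ℂ) :
    HasCoords (projY (corner τ z)) (coords τ (z.1 * z.2) 1 z.1) := by
  cases τ
  · exact hasCoords_chartOne_symm _ z
  · exact hasCoords_chartTwo_symm _ z

theorem eq_of_coords {y y' : Y} {τ : Bool} {x₀ x₁ x₂ : ℂ}
    (hy : HasCoords (projY y) (coords τ x₀ x₁ x₂)) (hy' : HasCoords (projY y') (coords τ x₀ x₁ x₂))
    (h : x₀ ≠ 0 ∨ x₁ ≠ 0 ∧ x₂ ≠ 0) : y = y' :=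
  Blowup.eq_of_proj_eq (notMem_base hy' h) (hy.eq hy')

/-- Points of the affine plane are not blown up, so equality in `Y` can be tested on homogeneous
coordinates. All local expressions of the map are verified through this. -/
theorem eq_affine_iff {y : Y} {τ : Bool} {x₀ x₁ x₂ : ℂ}
    (hy : HasCoords (projY y) (coords τ x₀ x₁ x₂)) {z : ℂ × ℂ} :
    y = affine τ z ↔ x₀ ≠ 0 ∧ z = (x₁ / x₀, x₂ / x₀) := by
  constructor
  · rintro rfl
    obtain ⟨t, ht, h⟩ := (hasCoords_affine τ z).smul_eq hy
    rw [smul_coords, coords_inj] at h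
    obtain ⟨rfl, rfl, rfl⟩ := h
    exact ⟨by simpa using ht, by simp [ht]⟩
  · rintro ⟨h0, rfl⟩
    refine eq_of_coords hy ?_ (Or.inl h0)
    have := (hasCoords_affine τ (x₁ / x₀, x₂ / x₀)).smul h0
    rw [smul_coords] at this
    simpa [mul_div_cancel₀ _ h0] using this

/-- Four strata: the affine plane, each exceptional curve off the line at infinity, that line off
its two ends, and these ends, the directions of slope `0` in the corner charts. -/
theorem exists_param_aux (y : Y) :
    (∃ z, y = affine false z) ∨ (∃ τ t, y = side τ (0, t)) ∨ (∃ t, y = corner false (t, 0)) ∨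
      ∃ τ, y = corner τ (0, 0) := by
  rcases y with ⟨P, hP⟩ | ⟨s, hs, v⟩
  · obtain ⟨x₀, x₁, x₂, hv⟩ := exists_eq_coords false P.rep
    have hc := hasCoords_rep P
    rw [hv] at hc
    by_cases h0 : x₀ = 0
    · subst h0
      have hP' : P ≠ eOne ∧ P ≠ eTwo := by simpa using hP
      have h1 : x₁ ≠ 0 := by
        rintro rfl
        have h2 : x₂ ≠ 0 := by
          rintro rfl
          exact P.rep_nonzero (by rw [hv]; simp [coords])
        refine hP'.2 (hc.eq ?_)
        simpa [smul_coords] using hasCoords_eTwo.smul h2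
      have h2 : x₂ ≠ 0 := by
        rintro rfl
        refine hP'.1 (hc.eq ?_)
        simpa [smul_coords] using hasCoords_eOne.smul h1
      refine Or.inr (Or.inr (Or.inl ⟨x₂ / x₁, ?_⟩))
      refine eq_of_coords (τ := false) hc ?_ (Or.inr ⟨h1, h2⟩)
      have := (hasCoords_corner false (x₂ / x₁, 0)).smul h1
      simpa [smul_coords, mul_div_cancel₀ _ h1] using this
    · exact Or.inl ⟨_, (eq_affine_iff (y := Blowup.pt P hP) hc).2 ⟨h0, rfl⟩⟩
  · have hs' : s = eOne ∨ s = eTwo := by simpa using hs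
    rcases hs' with rfl | rfl
    · by_cases hv : v.rep.2 = 0
      · have hv1 : v.rep.1 ≠ 0 := fun h => v.rep_nonzero (Prod.ext h hv)
        have hm : Blowup.dir eOne hs v ∈ (chartOne (.refl ℂ _)).source := ⟨rfl, hv1⟩
        refine Or.inr (Or.inr (Or.inr ⟨false, ((chartOne (.refl ℂ _)).left_inv hm).symm.trans ?_⟩))
        refine congrArg (chartOne (.refl ℂ _)).symm (Prod.ext rfl ?_)
        change v.rep.2 / v.rep.1 = 0
        simp [hv]
      · have hm : Blowup.dir eOne hs v ∈ (chartOne (.prodComm ℂ ℂ ℂ)).source := ⟨rfl, hv⟩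
        exact Or.inr (Or.inl ⟨false, _, ((chartOne (.prodComm ℂ ℂ ℂ)).left_inv hm).symm⟩)
    · by_cases hv : v.rep.1 = 0
      · have hv1 : v.rep.2 ≠ 0 := fun h => v.rep_nonzero (Prod.ext hv h)
        have hm : Blowup.dir eTwo hs v ∈ (chartTwo (.prodComm ℂ ℂ ℂ)).source := ⟨rfl, hv1⟩
        refine Or.inr (Or.inr (Or.inr ⟨true,
          ((chartTwo (.prodComm ℂ ℂ ℂ)).left_inv hm).symm.trans ?_⟩))
        refine congrArg (chartTwo (.prodComm ℂ ℂ ℂ)).symm (Prod.ext rfl ?_)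
        change v.rep.1 / v.rep.2 = 0
        simp [hv]
      · have hm : Blowup.dir eTwo hs v ∈ (chartTwo (.refl ℂ _)).source := ⟨rfl, hv⟩
        exact Or.inr (Or.inl ⟨true, _, ((chartTwo (.refl ℂ _)).left_inv hm).symm⟩)

/-- The parametrizations cover `Y`. -/
theorem exists_param (τ : Bool) (y : Y) :
    (∃ z, y = affine τ z) ∨ (∃ t, y = side τ (0, t)) ∨ (∃ t, y = side (!τ) (0, t)) ∨
      (∃ t, y = corner τ (t, 0)) ∨ y = corner (!τ) (0, 0) := by
  rcases exists_param_aux y with ⟨z, rfl⟩ | ⟨σ, t, rfl⟩ | ⟨t, rfl⟩ | ⟨σ, rfl⟩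
  · cases τ
    · exact Or.inl ⟨z, rfl⟩
    · exact Or.inl ⟨z.swap, rfl⟩
  · by_cases h : σ = τ
    · exact Or.inr (Or.inl ⟨t, by rw [h]⟩)
    · exact Or.inr (Or.inr (Or.inl ⟨t, by rw [Bool.eq_not.2 h]⟩))
  · cases τ
    · exact Or.inr (Or.inr (Or.inr (Or.inl ⟨t, rfl⟩)))
    · by_cases ht : t = 0
      · simp [ht]
      -- Exchanging `x` and `y` inverts the coordinate `y / x` on the line at infinity.
      · refine Or.inr (Or.inr (Or.inr (Or.inl ⟨t⁻¹, ?_⟩)))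
        refine eq_of_coords (τ := false) (hasCoords_corner false (t, 0)) ?_
          (Or.inr ⟨one_ne_zero, ht⟩)
        have := (hasCoords_corner true (t⁻¹, 0)).smul ht
        rw [show true = !false from rfl, coords_not, smul_coords] at this
        simpa [ht] using this
  · by_cases h : σ = τ
    · exact Or.inr (Or.inr (Or.inr (Or.inl ⟨0, by rw [h]⟩)))
    · exact Or.inr (Or.inr (Or.inr (Or.inr (by rw [Bool.eq_not.2 h]))))

/-- The points of the affine plane off finitely many coordinate lines are dense in `Y`. -/
theorem dense_affine (τ : Bool) {F G : Set ℂ} (hF : F.Finite) (hG : G.Finite) :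
    Dense {y : Y | ∃ z : ℂ × ℂ, z.1 ∉ F ∧ z.2 ∉ G ∧ y = affine τ z} := by
  set D := {y : Y | ∃ z : ℂ × ℂ, z.1 ∉ F ∧ z.2 ∉ G ∧ y = affine τ z}
  have hd : ∀ {F G : Set ℂ}, F.Finite → G.Finite → Dense {z : ℂ × ℂ | z.1 ∉ F ∧ z.2 ∉ G} := by
    intro F G hF hG
    exact (hF.countable.dense_compl ℂ).prod (hG.countable.dense_compl ℂ)
  -- Each parametrization is continuous on all of `ℂ × ℂ`, so a dense set of parameters suffices.
  have key : ∀ (a : ℂ × ℂ → Y) (s : Set (ℂ × ℂ)) (C : Set Y), Continuous a → Dense s →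
      (∀ z ∈ s, a z ∈ closure C) → ∀ z, a z ∈ closure C := by
    intro a s C ha hs h z
    have := map_mem_closure ha (hs z) (t := closure C) h
    rwa [closure_closure] at this
  have hA : ∀ z, affine τ z ∈ closure D :=
    key _ _ D (isParam_affine τ).choose_spec.continuous (hd hF hG)
      fun z hz => subset_closure ⟨z, hz.1, hz.2, rfl⟩
  have h0 : Dense {z : ℂ × ℂ | z.1 ∉ ({0} : Set ℂ) ∧ z.2 ∉ ({0} : Set ℂ)} :=
    hd (Set.finite_singleton 0) (Set.finite_singleton 0)
  have hcov : ∀ σ, (∀ z, side σ z ∈ closure D) ∧ ∀ z, corner σ z ∈ closure D := by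
    have haff : ∀ (y : Y) (σ : Bool) (x₀ x₁ x₂ : ℂ), HasCoords (projY y) (coords σ x₀ x₁ x₂) →
        x₀ ≠ 0 → y ∈ closure D := by
      intro y σ x₀ x₁ x₂ hy hx
      by_cases hσ : σ = τ
      · subst hσ
        rw [(eq_affine_iff hy).2 ⟨hx, rfl⟩]
        exact hA _
      · obtain rfl : σ = !τ := by cases σ <;> cases τ <;> simp_all
        rw [coords_not] at hy
        rw [(eq_affine_iff hy).2 ⟨hx, rfl⟩]
        exact hA _
    intro σ
    refine ⟨key _ _ D (isParam_side σ).choose_spec.continuous h0 fun z hz => ?_,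
      key _ _ D (isParam_corner σ).choose_spec.continuous h0 fun z hz => ?_⟩
    · exact haff _ σ _ _ _ (hasCoords_side σ z) (by simpa using hz.1)
    · exact haff _ σ _ _ _ (hasCoords_corner σ z)
        (mul_ne_zero (by simpa using hz.1) (by simpa using hz.2))
  intro y
  rcases exists_param τ y with ⟨z, rfl⟩ | ⟨t, rfl⟩ | ⟨t, rfl⟩ | ⟨t, rfl⟩ | rfl
  · exact hA z
  · exact (hcov _).1 _
  · exact (hcov _).1 _
  · exact (hcov _).2 _
  · exact (hcov _).2 _

end LinFrac

/-! ### Limits and holomorphic germs of relations -/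

section Germ

variable {X : Type*} [TopologicalSpace X]

/-- `y` is the limit of the relation `Γ` at `x`. -/
def LimTo (Γ : X → X → Prop) (x y : X) : Prop :=
  ∀ U ∈ 𝓝 y, ∀ᶠ x' in 𝓝 x, ∀ y', Γ x' y' → y' ∈ U

/-- Density of the domain is what excludes vacuous limits: near `x` there is a pair of `Γ`, whose
second entry would lie in two disjoint neighbourhoods. -/
theorem LimTo.unique [T2Space X] {Γ : X → X → Prop} (hΓ : Dense {x | ∃ y, Γ x y}) {x y y' : X}
    (h : LimTo Γ x y) (h' : LimTo Γ x y') : y = y' := by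
  by_contra hne
  obtain ⟨U, V, hU, hV, hy, hy', hUV⟩ := t2_separation hne
  obtain ⟨x', ⟨z, hz⟩, h1, h2⟩ := ((mem_closure_iff_frequently.1 (hΓ x)).and_eventually
    ((h U (hU.mem_nhds hy)).and (h' V (hV.mem_nhds hy')))).exists
  exact Set.disjoint_left.1 hUV (h1 z hz) (h2 z hz)


/-- A map whose limits determine the point has no exceptional curves. -/
theorem not_accPt_of_unique {Γ : X → X → Prop} {x y : X} (hu : ∀ x', LimTo Γ x' y → x' = x) :
    ¬ AccPt x (Filter.principal {x' | LimTo Γ x' y}) := by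
  rw [accPt_iff_frequently]
  intro h
  obtain ⟨x', hne, hx'⟩ := h.exists
  exact hne (hu x' hx')

variable [ChartedSpace (ℂ × ℂ) X]

/-- The relation `Γ` is near `x` contained in the graph of the holomorphic germ `Φ`. -/
structure Germ (Γ : X → X → Prop) (Φ : X → X) (x : X) : Prop where
  hol : HolAt Φ x
  eq : ∀ᶠ x' in 𝓝 x, ∀ y', Γ x' y' → y' = Φ x'

variable {Γ Γ' : X → X → Prop} {Φ Ψ : X → X} {x : X}

theorem Germ.limTo (h : Germ Γ Φ x) : LimTo Γ x (Φ x) := by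
  intro U hU
  filter_upwards [h.eq, h.hol.continuousAt.eventually hU] with x' h1 h2 y' hy
  rw [h1 y' hy]
  exact h2

variable [IsManifold 𝓘(ℂ, ℂ × ℂ) ω X]

theorem Germ.eventually (h : Germ Γ Φ x) : ∀ᶠ x' in 𝓝 x, Germ Γ Φ x' := by
  filter_upwards [(contMDiffAt_iff_contMDiffAt_nhds (by simp)).1 h.hol,
    h.eq.eventually_nhds] with x' h1 h2 using ⟨h1, h2⟩

/-- Germs of mutually inverse relations are inverse to each other. -/
theorem Germ.inverse [T2Space X] (h : Germ Γ Φ x) (h' : Germ Γ' Ψ (Φ x))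
    (hd : Dense {x | ∃ y, Γ x y ∧ Γ' y x}) : ∀ᶠ x' in 𝓝 x, Ψ (Φ x') = x' := by
  filter_upwards [h.eventually, h.hol.continuousAt.eventually h'.eventually] with x' h1 h2
  -- If `Ψ ∘ Φ` moves `x'`, it moves all nearby points, among them one with a pair in `Γ` whose
  -- reverse is in `Γ'`; but the germs must follow that pair forth and back.
  by_contra hne
  have hc : ContinuousAt (fun x => Ψ (Φ x)) x' :=
    ContinuousAt.comp h2.hol.continuousAt h1.hol.continuousAt
  obtain ⟨x'', ⟨y, hy, hy'⟩, h3, h4, h5⟩ := ((mem_closure_iff_frequently.1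
    (hd x')).and_eventually (((hc.ne_iff_eventually_ne continuousAt_id).1 hne).and
      (h1.eq.and (h1.hol.continuousAt.eventually h2.eq)))).exists
  rw [h4 y hy] at hy'
  exact h3 (h5 x'' hy').symm

/-- Two mutually inverse relations with holomorphic germs everywhere give a biholomorphic map. -/
theorem exists_diffeomorph [T2Space X] (h : ∀ x, ∃ Φ, Germ Γ Φ x) (h' : ∀ x, ∃ Φ, Germ Γ' Φ x)
    (hd : Dense {x | ∃ y, Γ x y ∧ Γ' y x}) (hd' : Dense {x | ∃ y, Γ' x y ∧ Γ y x}) :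
    ∃ F : X ≃ₘ^ω⟮𝓘(ℂ, ℂ × ℂ), 𝓘(ℂ, ℂ × ℂ)⟯ X,
      (∀ x, LimTo Γ x (F x)) ∧ ∀ x, LimTo Γ' x (F.symm x) := by
  choose Φ hΦ using h
  choose Ψ hΨ using h'
  have hcl : ∀ {Γ Γ' : X → X → Prop}, Dense {x | ∃ y, Γ x y ∧ Γ' y x} → Dense {x | ∃ y, Γ x y} :=
    fun h => h.mono fun x hx => hx.imp fun y hy => hy.1
  have hF : ∀ {Γ Γ' : X → X → Prop}, Dense {x | ∃ y, Γ x y ∧ Γ' y x} →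
      ∀ Φ : X → X → X, (∀ x, Germ Γ (Φ x) x) →
      ContMDiff 𝓘(ℂ, ℂ × ℂ) 𝓘(ℂ, ℂ × ℂ) ω (fun x => Φ x x) := by
    intro Γ Γ' hd Φ hΦ x
    -- The germ chosen at `x` also computes the limits at nearby points, so by uniqueness it agrees
    -- there with the germs chosen at those points.
    refine (hΦ x).hol.congr_of_eventuallyEq ?_
    filter_upwards [(hΦ x).eventually] with x' hx'
    exact (hΦ x').limTo.unique (hcl hd) hx'.limTo
  exact ⟨{ toFun := fun x => Φ x x
           invFun := fun x => Ψ x x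
           left_inv := fun x => ((hΦ x).inverse (hΨ _) hd).self_of_nhds
           right_inv := fun x => ((hΨ x).inverse (hΦ _) hd').self_of_nhds
           contMDiff_toFun := hF hd Φ hΦ
           contMDiff_invFun := hF hd' Ψ hΨ }, fun x => (hΦ x).limTo, fun x => (hΨ x).limTo⟩

end Germ

theorem Principal.precomp {M N N' : Type*} [TopologicalSpace M] [ChartedSpace (ℂ × ℂ) M]
    [TopologicalSpace N] [ChartedSpace (ℂ × ℂ) N] [TopologicalSpace N'] [ChartedSpace (ℂ × ℂ) N']
    {ψ : OpenPartialHomeomorph M (ℂ × ℂ)} {φ : N → M} {π : N' → N} {ν : N'}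
    (hP : Principal ψ φ (π ν)) (hπ : HolAt π ν) : Principal ψ (fun ν' => φ (π ν')) ν := by
  obtain ⟨h, w, hh, hw, hw0, he⟩ := hP
  exact ⟨fun ν' => h (π ν'), fun ν' => w (π ν'), ContMDiffAt.comp ν hh hπ,
    ContMDiffAt.comp (g := w) ν hw hπ, hw0, hπ.continuousAt.eventually he⟩

/-- A criterion for principality in terms of a parametrization of the target. -/
theorem LinFrac.IsParam.principal {M N : Type*} [TopologicalSpace M] [ChartedSpace (ℂ × ℂ) M]
    [IsManifold 𝓘(ℂ, ℂ × ℂ) ω M] [TopologicalSpace N] [ChartedSpace (ℂ × ℂ) N]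
    {a : ℂ × ℂ → M} {a' : M → ℂ × ℂ} (ha : IsParam a a') {ζ : N → ℂ × ℂ} {ν : N}
    (hζ : ContinuousAt ζ ν) {h : N → ℂ} {w : N → ℂ × ℂ}
    (hh : ContMDiffAt 𝓘(ℂ, ℂ × ℂ) 𝓘(ℂ, ℂ) ω h ν) (hw : HolAt w ν) (hw0 : w ν ≠ 0)
    (he : ∀ᶠ ν' in 𝓝 ν, ζ ν' = ζ ν + h ν' • w ν') :
    Principal (chartAt (ℂ × ℂ) (a (ζ ν))) (fun ν' => a (ζ ν')) ν := by
  have hP : Principal (chartAt (ℂ × ℂ) (ζ ν)) ζ ν := ⟨h, w, hh, hw, hw0, he⟩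
  exact hP.comp (IsManifold.chart_mem_maximalAtlas _) hζ (mem_chart_source _ _)
    (IsManifold.chart_mem_maximalAtlas _) (g := a) (g' := a') (ha.hol _) (ha.hol_inv _)
    (mem_chart_source _ _) (.of_forall ha.left_inv)

namespace LinFrac

/-! ### The germs of the recurrence on `Y` -/

/-- The data of the map `(x, y) ↦ (y, r + κ (y - c) / (x - b))` of the affine plane, in coordinates
which are exchanged if `swap` is true. -/
structure Params where
  swap : Bool
  b : ℂ
  c : ℂ
  r : ℂ
  κ : ℂ
  ne : κ ≠ 0

namespace Params

variable (D : Params)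

/-- The parameters of the inverse map. -/
def inv : Params where
  swap := !D.swap
  b := D.r
  c := D.c
  r := D.b
  κ := D.κ
  ne := D.ne

theorem inv_inv : D.inv.inv = D := by
  cases D
  simp [inv]

/-- The map in affine coordinates. -/
noncomputable def map (z : ℂ × ℂ) : ℂ × ℂ := (z.2, D.r + D.κ * (z.2 - D.c) / (z.1 - D.b))

/-- The point of indeterminacy. -/
noncomputable def p : Y := affine D.swap (D.b, D.c)

/-- The point of indeterminacy of the inverse. -/
noncomputable def q : Y := affine D.swap (D.c, D.r)

theorem inv_p : D.inv.p = D.q := affine_not _ _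

theorem inv_q : D.inv.q = D.p := affine_not _ _

/-- The graph of the map on the affine plane. -/
def Graph (y y' : Y) : Prop :=
  ∃ z : ℂ × ℂ, z.1 ≠ D.b ∧ y = affine D.swap z ∧ y' = affine D.swap (D.map z)

/-- The graph can be reversed off the lines `x = b` and `y = c`. The freedom to avoid further lines
serves later to keep images off the blown-up points. -/
theorem dense_graph_inv_off {F G : Set ℂ} (hF : F.Finite) (hG : G.Finite) :
    Dense {y | ∃ y', ((∃ z : ℂ × ℂ, z.1 ∉ F ∧ z.2 ∉ G ∧ y = affine D.swap z ∧
      y' = affine D.swap (D.map z)) ∧ D.Graph y y' ∧ D.inv.Graph y' y)} := by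
  refine (dense_affine D.swap (hF.insert D.b) (hG.insert D.c)).mono ?_
  rintro _ ⟨z, h1, h2, rfl⟩
  simp only [Set.mem_insert_iff, not_or] at h1 h2
  have hb : z.1 - D.b ≠ 0 := sub_ne_zero.2 h1.1
  have hc : z.2 - D.c ≠ 0 := sub_ne_zero.2 h2.1
  have hm : D.inv.map (D.map z).swap = z.swap := by
    refine Prod.ext rfl ?_
    simp only [map, inv, Prod.fst_swap, Prod.snd_swap]
    have := D.ne
    field_simp
    ring
  refine ⟨_, ⟨z, h1.2, h2.2, rfl, rfl⟩, ⟨z, h1.1, rfl, rfl⟩, ⟨(D.map z).swap, ?_, ?_, ?_⟩⟩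
  · have : D.r + D.κ * (z.2 - D.c) / (z.1 - D.b) - D.r ≠ 0 := by
      rw [add_sub_cancel_left]
      exact div_ne_zero (mul_ne_zero D.ne hc) hb
    exact sub_ne_zero.1 this
  · exact ((affine_not D.swap _).trans (by rw [Prod.swap_swap])).symm
  · rw [hm]
    exact ((affine_not D.swap _).trans (by rw [Prod.swap_swap])).symm

theorem dense_graph_inv : Dense {y | ∃ y', D.Graph y y' ∧ D.inv.Graph y' y} := by
  refine (D.dense_graph_inv_off Set.finite_empty Set.finite_empty).mono ?_
  rintro _ ⟨y', h⟩
  exact ⟨y', h.2⟩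

theorem dense_graph : Dense {y | ∃ y', D.Graph y y'} := by
  refine D.dense_graph_inv.mono ?_
  rintro _ ⟨y', h⟩
  exact ⟨y', h.1⟩

variable {D}

/-- The expression `g` has to match the map only at points of the affine graph; its holomorphy then
extends the map across the curves at infinity and the poles. -/
theorem _root_.LinFrac.IsParam.germ {P Q : ℂ × ℂ → Y} {P' Q' : Y → ℂ × ℂ} (hP : IsParam P P')
    (hQ : IsParam Q Q') {g : ℂ × ℂ → ℂ × ℂ} {z₀ : ℂ × ℂ} (hg : ContDiffAt ℂ ω g z₀)
    (h : ∀ᶠ z in 𝓝 z₀, ∀ x, P z = affine D.swap x → x.1 ≠ D.b →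
      Q (g z) = affine D.swap (D.map x)) :
    Germ D.Graph (fun y => Q (g (P' y))) (P z₀) := by
  have h1 : HolAt (fun y => g (P' y)) (P z₀) :=
    ContMDiffAt.comp (g := g) _ (by rw [hP.left_inv]; exact hg.contMDiffAt) (hP.hol_inv z₀)
  refine ⟨ContMDiffAt.comp (g := Q) _ (hQ.hol _) h1, ?_⟩
  have hc := (hP.hol_inv z₀).continuousAt
  rw [ContinuousAt, hP.left_inv] at hc
  filter_upwards [hc.eventually h, hP.right_inv z₀] with y h1 h2
  rintro y' ⟨x, hx, rfl, rfl⟩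
  exact (h1 x h2 hx).symm

theorem germ_of_param {P Q : ℂ × ℂ → Y} (hP : ∃ P', IsParam P P') (hQ : ∃ Q', IsParam Q Q')
    {g : ℂ × ℂ → ℂ × ℂ} {z₀ z₁ : ℂ × ℂ} (hg : ContDiffAt ℂ ω g z₀) (hz : g z₀ = z₁)
    (h : ∀ᶠ z in 𝓝 z₀, ∀ x, P z = affine D.swap x → x.1 ≠ D.b →
      Q (g z) = affine D.swap (D.map x)) :
    ∃ Φ, Germ D.Graph Φ (P z₀) ∧ Φ (P z₀) = Q z₁ := by
  obtain ⟨P', hP⟩ := hP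
  obtain ⟨Q', hQ⟩ := hQ
  exact ⟨_, hP.germ hQ hg h, by rw [hP.left_inv, hz]⟩

/-- If moreover the local expression of the map is `g z₀ + h • w`, then the image point pulls back
to a principal ideal. -/
theorem exists_germ_principal_of_param {P Q : ℂ × ℂ → Y} (hP : ∃ P', IsParam P P')
    (hQ : ∃ Q', IsParam Q Q') {g : ℂ × ℂ → ℂ × ℂ} {z₀ z₁ : ℂ × ℂ} (hz : g z₀ = z₁)
    (h : ∀ᶠ z in 𝓝 z₀, ∀ x, P z = affine D.swap x → x.1 ≠ D.b →
      Q (g z) = affine D.swap (D.map x))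
    {f : ℂ × ℂ → ℂ} {w : ℂ × ℂ → ℂ × ℂ} (hf : ContDiffAt ℂ ω f z₀) (hw : ContDiffAt ℂ ω w z₀)
    (hw0 : w z₀ ≠ 0) (hg : ∀ z, g z = z₁ + f z • w z) :
    ∃ Φ, Germ D.Graph Φ (P z₀) ∧ Φ (P z₀) = Q z₁ ∧
      Principal (chartAt (ℂ × ℂ) (Φ (P z₀))) Φ (P z₀) := by
  obtain ⟨P', hP⟩ := hP
  obtain ⟨Q', hQ⟩ := hQ
  have hgc : ContDiffAt ℂ ω g z₀ := by
    rw [funext hg]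
    exact contDiffAt_const.add (hf.smul hw)
  have h1 : HolAt (fun y => g (P' y)) (P z₀) :=
    ContMDiffAt.comp (g := g) _ (by rw [hP.left_inv]; exact hgc.contMDiffAt) (hP.hol_inv z₀)
  refine ⟨_, hP.germ hQ hgc h, by rw [hP.left_inv, hz], ?_⟩
  refine hQ.principal h1.continuousAt
    (ContMDiffAt.comp (g := f) _ (by rw [hP.left_inv]; exact hf.contMDiffAt) (hP.hol_inv z₀))
    (ContMDiffAt.comp (g := w) _ (by rw [hP.left_inv]; exact hw.contMDiffAt) (hP.hol_inv z₀))
    (by rwa [Function.comp_apply, hP.left_inv]) (.of_forall fun y => ?_)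
  rw [hP.left_inv, hz]
  exact hg _

theorem hasCoords_side_not (τ : Bool) (z : ℂ × ℂ) :
    HasCoords (projY (side (!τ) z)) (coords τ z.1 (z.1 * z.2) 1) := by
  rw [← coords_not]
  exact hasCoords_side _ z

theorem hasCoords_corner_not (τ : Bool) (z : ℂ × ℂ) :
    HasCoords (projY (corner (!τ) z)) (coords τ (z.1 * z.2) z.1 1) := by
  rw [← coords_not]
  exact hasCoords_corner _ z

theorem germ_affine {z : ℂ × ℂ} (hz : z.1 ≠ D.b) :
    ∃ Φ, Germ D.Graph Φ (affine D.swap z) ∧ Φ (affine D.swap z) = affine D.swap (D.map z) := by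
  refine germ_of_param (isParam_affine _) (isParam_affine _) ?_ rfl
    (.of_forall fun z x hx _ => ?_)
  · have : z.1 - D.b ≠ 0 := sub_ne_zero.2 hz
    unfold map
    fun_prop (disch := assumption)
  · rw [(isParam_affine _).choose_spec.injective hx]

/-- The second coordinate has a pole along `x = b`; where `y ≠ c` its reciprocal is holomorphic, and
the image lies on the exceptional curve where that coordinate is infinite. -/
theorem germ_affine_pole {y : ℂ} (hy : y ≠ D.c) :
    ∃ Φ, Germ D.Graph Φ (affine D.swap (D.b, y)) ∧
      Φ (affine D.swap (D.b, y)) = side (!D.swap) (0, y) := by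
  have h0 : (D.b - D.b) * D.r + D.κ * (y - D.c) ≠ 0 := by
    rw [sub_self, zero_mul, zero_add]
    exact mul_ne_zero D.ne (sub_ne_zero.2 hy)
  refine germ_of_param (D := D) (isParam_affine D.swap) (isParam_side (!D.swap))
    (g := fun z => ((z.1 - D.b) / ((z.1 - D.b) * D.r + D.κ * (z.2 - D.c)), z.2)) (z₀ := (D.b, y))
    (by fun_prop (disch := assumption)) (by simp) ?_
  · have hc : ContinuousAt (fun z : ℂ × ℂ => (z.1 - D.b) * D.r + D.κ * (z.2 - D.c)) (D.b, y) := by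
      fun_prop
    filter_upwards [hc.eventually_ne h0] with z hz x hx hxb
    obtain rfl := (isParam_affine _).choose_spec.injective hx
    have hxb' : z.1 - D.b ≠ 0 := sub_ne_zero.2 hxb
    refine (eq_affine_iff (hasCoords_side_not D.swap _)).2 ⟨div_ne_zero hxb' hz, ?_⟩
    refine Prod.ext ?_ ?_
    · simp only [map]
      field_simp
    · simp only [map]
      field_simp

/-- The map in the coordinates `(1 / x, y)`. -/
noncomputable def sideMap (D : Params) (z : ℂ × ℂ) : ℂ × ℂ :=
  (z.2, D.r + D.κ * (z.2 - D.c) * z.1 / (1 - D.b * z.1))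

theorem affine_sideMap {z x : ℂ × ℂ} (hx : side D.swap z = affine D.swap x) (hxb : x.1 ≠ D.b) :
    affine D.swap (D.sideMap z) = affine D.swap (D.map x) := by
  obtain ⟨hw, rfl⟩ := (eq_affine_iff (hasCoords_side D.swap z)).1 hx
  have hxb' : 1 - D.b * z.1 ≠ 0 := fun h => hxb (by
    simp only
    field_simp
    linear_combination h)
  congr 1
  refine Prod.ext ?_ ?_
  · simp only [sideMap, map]
    field_simp
  · simp only [sideMap, map]
    field_simp

/-- As `x → ∞` the fraction vanishes: this exceptional curve goes to the line of points with second
coordinate `r`. -/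
theorem germ_side (t : ℂ) :
    ∃ Φ, Germ D.Graph Φ (side D.swap (0, t)) ∧
      Φ (side D.swap (0, t)) = affine D.swap (t, D.r) := by
  have h0 : 1 - D.b * (0 : ℂ) ≠ 0 := by simp
  refine germ_of_param (isParam_side D.swap) (isParam_affine D.swap) (g := D.sideMap) ?_
    (by simp [sideMap]) (.of_forall fun z x => affine_sideMap)
  unfold sideMap
  fun_prop (disch := assumption)

/-- The image of `(x, y)` has first coordinate `y` and second coordinate asymptotic to `κ y / (x -
b)`, so as `y → ∞` it tends to the line at infinity, with ratio of coordinates depending on `x`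
alone. -/
theorem germ_side_not (t : ℂ) :
    ∃ Φ, Germ D.Graph Φ (side (!D.swap) (0, t)) ∧
      Φ (side (!D.swap) (0, t)) = corner (!D.swap) ((t - D.b) / D.κ, 0) := by
  have h0 : 0 * (t - D.b) * D.r + D.κ * (1 - 0 * D.c) ≠ 0 := by simpa using D.ne
  refine germ_of_param (D := D) (isParam_side (!D.swap)) (isParam_corner (!D.swap))
    (g := fun z => ((z.2 - D.b) / (z.1 * (z.2 - D.b) * D.r + D.κ * (1 - z.1 * D.c)), z.1))
    (z₀ := (0, t)) (by fun_prop (disch := assumption)) (by simp) ?_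
  · have hc : ContinuousAt (fun z : ℂ × ℂ => z.1 * (z.2 - D.b) * D.r + D.κ * (1 - z.1 * D.c))
      (0, t) := by fun_prop
    filter_upwards [hc.eventually_ne h0] with z hz x hx hxb
    obtain ⟨hw, rfl⟩ := (eq_affine_iff (hasCoords_side_not D.swap z)).1 hx
    simp only [mul_div_cancel_left₀ _ hw] at hxb ⊢
    have hxb' : z.2 - D.b ≠ 0 := sub_ne_zero.2 hxb
    refine (eq_affine_iff (hasCoords_corner_not D.swap _)).2
      ⟨mul_ne_zero (div_ne_zero hxb' hz) hw, ?_⟩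
    refine Prod.ext ?_ ?_
    · simp only [map]
      field_simp
    · simp only [map]
      field_simp

/-- Near infinity `(y - c) / (x - b)` tends to `y / x`, so the line at infinity goes to the
exceptional curve where the first coordinate is infinite. -/
theorem germ_corner (t : ℂ) :
    ∃ Φ, Germ D.Graph Φ (corner D.swap (t, 0)) ∧
      Φ (corner D.swap (t, 0)) = side D.swap (0, D.r + D.κ * t) := by
  have h0 : 1 - D.b * t * (0 : ℂ) ≠ 0 := by simp
  refine germ_of_param (D := D) (isParam_corner D.swap) (isParam_side D.swap)
    (g := fun z => (z.2, D.r + D.κ * z.1 * (1 - D.c * z.2) / (1 - D.b * z.1 * z.2))) (z₀ := (t, 0))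
    (by fun_prop (disch := assumption)) (by simp) ?_
  · have hc : ContinuousAt (fun z : ℂ × ℂ => 1 - D.b * z.1 * z.2) (t, 0) := by fun_prop
    filter_upwards [hc.eventually_ne h0] with z hz x hx hxb
    obtain ⟨hw, rfl⟩ := (eq_affine_iff (hasCoords_corner D.swap z)).1 hx
    have hw1 : z.1 ≠ 0 := left_ne_zero_of_mul hw
    have hw2 : z.2 ≠ 0 := right_ne_zero_of_mul hw
    refine (eq_affine_iff (hasCoords_side D.swap _)).2 ⟨hw2, ?_⟩
    have hz' : 1 - z.1 * z.2 * D.b ≠ 0 := by convert! hz using 1; ring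
    refine Prod.ext ?_ ?_
    · simp only [map]
      field_simp
    · simp only [map]
      field_simp

/-- The one point not reached by the other charts: the end of the line at infinity on the
exceptional curve `y = ∞`. It goes to the opposite end. -/
theorem germ_corner_not :
    ∃ Φ, Germ D.Graph Φ (corner (!D.swap) (0, 0)) ∧
      Φ (corner (!D.swap) (0, 0)) = corner D.swap (0, 0) := by
  have h0 : 0 * D.r * (1 - 0 * D.b) + D.κ * (1 - 0 * 0 * D.c) ≠ 0 := by simpa using D.ne
  have h0' : 1 - (0 : ℂ) * D.b ≠ 0 := by simp
  refine germ_of_param (D := D) (isParam_corner (!D.swap)) (isParam_corner D.swap)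
    (g := fun z => (z.2 * (z.1 * D.r * (1 - z.2 * D.b) + D.κ * (1 - z.1 * z.2 * D.c)) /
        (1 - z.2 * D.b),
      z.1 * (1 - z.2 * D.b) / (z.1 * D.r * (1 - z.2 * D.b) + D.κ * (1 - z.1 * z.2 * D.c))))
    (z₀ := (0, 0)) (by fun_prop (disch := assumption)) (by simp) ?_
  · have hc : ContinuousAt (fun z : ℂ × ℂ => z.1 * D.r * (1 - z.2 * D.b) +
      D.κ * (1 - z.1 * z.2 * D.c)) (0, 0) := by fun_prop
    have hc' : ContinuousAt (fun z : ℂ × ℂ => 1 - z.2 * D.b) (0, 0) := by fun_prop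
    filter_upwards [hc.eventually_ne h0, hc'.eventually_ne h0'] with z hz hz' x hx hxb
    obtain ⟨hw, rfl⟩ := (eq_affine_iff (hasCoords_corner_not D.swap z)).1 hx
    have hw1 : z.1 ≠ 0 := left_ne_zero_of_mul hw
    have hw2 : z.2 ≠ 0 := right_ne_zero_of_mul hw
    refine (eq_affine_iff (hasCoords_corner D.swap _)).2
      ⟨mul_ne_zero (div_ne_zero (mul_ne_zero hw2 hz) hz')
        (div_ne_zero (mul_ne_zero hw1 hz') hz), ?_⟩
    refine Prod.ext ?_ ?_
    · simp only [map]
      field_simp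
    · simp only [map]
      field_simp

/-- Off the point of indeterminacy, the map of `Y` is defined and holomorphic. -/
theorem exists_germ {y : Y} (hy : y ≠ D.p) : ∃ Φ, Germ D.Graph Φ y := by
  rcases exists_param D.swap y with ⟨z, rfl⟩ | ⟨t, rfl⟩ | ⟨t, rfl⟩ | ⟨t, rfl⟩ | rfl
  · by_cases hb : z.1 = D.b
    · have hc : z.2 ≠ D.c := fun hc => hy (congrArg (affine D.swap) (Prod.ext hb hc))
      have := germ_affine_pole hc
      rw [← hb, Prod.mk.eta] at this
      exact this.imp fun _ h => h.1
    · exact (germ_affine hb).imp fun _ h => h.1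
  · exact (germ_side t).imp fun _ h => h.1
  · exact (germ_side_not t).imp fun _ h => h.1
  · exact (germ_corner t).imp fun _ h => h.1
  · exact germ_corner_not.imp fun _ h => h.1

end Params

end LinFrac

/-! ### Indeterminacy, fibres and the exceptional curve on `Y` -/

namespace LinFrac.Params

variable {D : Params}

/-- The exceptional curve of the map, without the point of indeterminacy. -/
def gammaCurve (D : Params) : Set Y :=
  {y | (∃ x, x ≠ D.b ∧ y = affine D.swap (x, D.c)) ∨ y = side D.swap (0, D.c)}

theorem limTo_affine {z : ℂ × ℂ} (hz : z.1 ≠ D.b) :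
    LimTo D.Graph (affine D.swap z) (affine D.swap (D.map z)) := by
  obtain ⟨Φ, h, h'⟩ := germ_affine hz
  exact h' ▸ h.limTo

theorem map_of_snd_eq {z : ℂ × ℂ} (hz : z.2 = D.c) : D.map z = (D.c, D.r) := by
  simp [map, hz]

theorem side_ne_affine (τ σ : Bool) (t : ℂ) (z : ℂ × ℂ) : side σ (0, t) ≠ affine τ z := by
  by_cases h : σ = τ
  · subst h
    exact fun h => ((eq_affine_iff (hasCoords_side σ _)).1 h).1 rfl
  · obtain rfl := Bool.eq_not.2 h
    exact fun h => ((eq_affine_iff (hasCoords_side_not τ _)).1 h).1 rfl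

theorem corner_ne_affine (τ σ : Bool) (t : ℂ) (z : ℂ × ℂ) : corner σ (t, 0) ≠ affine τ z := by
  by_cases h : σ = τ
  · subst h
    exact fun h => ((eq_affine_iff (hasCoords_corner σ _)).1 h).1 (mul_zero _)
  · obtain rfl := Bool.eq_not.2 h
    exact fun h => ((eq_affine_iff (hasCoords_corner_not τ _)).1 h).1 (mul_zero _)

/-- The map is not defined at the point of indeterminacy. -/
theorem not_limTo_p (y : Y) : ¬ LimTo D.Graph D.p y := by
  intro h
  -- Along the line of slope `m` through `p` the values tend to `(c, r + κ m)`, which depends on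
  -- `m`.
  have key : ∀ m : ℂ, y = affine D.swap (D.c, D.r + D.κ * m) := by
    intro m
    by_contra hne
    obtain ⟨U, V, hU, hV, hy, hy', hUV⟩ := t2_separation hne
    have hA := (isParam_affine D.swap).choose_spec.continuous
    have h1 : Filter.Tendsto (fun t : ℂ => affine D.swap (D.b + t, D.c + m * t)) (𝓝[≠] 0)
        (𝓝 D.p) := by
      have : ContinuousAt (fun t : ℂ => affine D.swap (D.b + t, D.c + m * t)) 0 := by fun_prop
      have h := this.tendsto.mono_left (nhdsWithin_le_nhds (s := {0}ᶜ))
      simpa [p] using h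
    have h2 : Filter.Tendsto (fun t : ℂ => affine D.swap (D.c + m * t, D.r + D.κ * m)) (𝓝[≠] 0)
        (𝓝 (affine D.swap (D.c, D.r + D.κ * m))) := by
      have : ContinuousAt (fun t : ℂ => affine D.swap (D.c + m * t, D.r + D.κ * m)) 0 := by
        fun_prop
      have h := this.tendsto.mono_left (nhdsWithin_le_nhds (s := {0}ᶜ))
      simpa using h
    obtain ⟨t, ⟨h3, h4⟩, h5⟩ := (((h1.eventually (h U (hU.mem_nhds hy))).and
      (h2.eventually (hV.mem_nhds hy'))).and self_mem_nhdsWithin).exists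
    have h5 : t ≠ 0 := h5
    refine Set.disjoint_left.1 hUV (h3 _ ⟨_, ?_, rfl, ?_⟩) h4
    · simpa using h5
    · simp only [map, add_sub_cancel_left]
      rw [← mul_assoc, mul_div_cancel_right₀ _ h5]
  have := (isParam_affine D.swap).choose_spec.injective ((key 0).symm.trans (key 1))
  simp [D.ne] at this

/-- Off the image of the exceptional curve, the inverse map is an inverse. -/
theorem limTo_inv {y y' : Y} (h : LimTo D.Graph y y') (hy' : y' ≠ D.q) :
    LimTo D.inv.Graph y' y := by
  have hy : y ≠ D.p := by
    rintro rfl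
    exact not_limTo_p _ h
  obtain ⟨Φ, hΦ⟩ := exists_germ hy
  obtain rfl := hΦ.limTo.unique D.dense_graph h
  obtain ⟨Ψ, hΨ⟩ := exists_germ (D := D.inv) (y := Φ y) (by rwa [D.inv_p])
  have := (hΦ.inverse hΨ D.dense_graph_inv).self_of_nhds
  have h' := hΨ.limTo
  rwa [this] at h'

/-- The exceptional curve is the fibre of the map over the point `q`. -/
theorem limTo_q_iff {y : Y} : LimTo D.Graph y D.q ↔ y ∈ D.gammaCurve := by
  constructor
  · intro h
    have hu : ∀ {y'}, (∃ Φ, Germ D.Graph Φ y ∧ Φ y = y') → D.q = y' := by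
      rintro y' ⟨Φ, h1, rfl⟩
      exact h.unique D.dense_graph h1.limTo
    have hy : y ≠ D.p := by
      rintro rfl
      exact not_limTo_p _ h
    -- Since `q` is in the affine plane, only points off the pole and points with `x = ∞` can reach
    -- it, and both force `y = c`.
    rcases exists_param D.swap y with ⟨z, rfl⟩ | ⟨t, rfl⟩ | ⟨t, rfl⟩ | ⟨t, rfl⟩ | rfl
    · by_cases hb : z.1 = D.b
      · have hc : z.2 ≠ D.c := fun hc => hy (congrArg (affine D.swap) (Prod.ext hb hc))
        have h' := germ_affine_pole hc
        rw [← hb, Prod.mk.eta] at h'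
        exact absurd (hu h').symm (side_ne_affine _ _ _ _)
      · refine Or.inl ⟨z.1, hb, ?_⟩
        have h' := congrArg Prod.snd
          ((isParam_affine D.swap).choose_spec.injective (hu (germ_affine hb)))
        have h0 : z.2 = D.c := by
          simpa [map, D.ne, sub_ne_zero.2 hb, sub_eq_zero] using h'
        rw [← h0]
    · right
      have h' := congrArg Prod.fst
        ((isParam_affine D.swap).choose_spec.injective (hu (germ_side t)))
      rw [← show D.c = t from h']
    · exact absurd (hu (germ_side_not t)).symm (corner_ne_affine _ _ _ _)
    · exact absurd (hu (germ_corner t)).symm (side_ne_affine _ _ _ _)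
    · exact absurd (hu germ_corner_not).symm (corner_ne_affine _ _ _ _)
  · rintro (⟨x, hx, rfl⟩ | rfl)
    · have := limTo_affine (D := D) (z := (x, D.c)) hx
      rwa [map_of_snd_eq rfl] at this
    · obtain ⟨Φ, h, h'⟩ := germ_side (D := D) D.c
      have := h.limTo
      rwa [h'] at this

theorem p_notMem_gammaCurve : D.p ∉ D.gammaCurve := fun h => not_limTo_p _ (limTo_q_iff.2 h)

theorem frequently_affine_curve {t : ℂ} {C : Set ℂ} (hC : C.Finite) (c : ℂ) :
    ∃ᶠ x in 𝓝 t, x ∉ C ∧ affine D.swap (x, c) ≠ affine D.swap (t, c) := by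
  have h : ∃ᶠ x in 𝓝 t, x ∈ (insert t C)ᶜ :=
    mem_closure_iff_frequently.1 ((hC.insert t).countable.dense_compl ℂ t)
  refine h.mono fun x hx => ?_
  have hx : ¬ (x = t ∨ x ∈ C) := hx
  refine ⟨fun h => hx (Or.inr h), fun h => hx (Or.inl ?_)⟩
  exact congrArg Prod.fst ((isParam_affine D.swap).choose_spec.injective h)

/-- The exceptional curve has no isolated points. -/
theorem accPt_gammaCurve {y : Y} (hy : y ∈ D.gammaCurve) :
    ∃ᶠ y' in 𝓝 y, y' ≠ y ∧ ∃ x, x ≠ D.b ∧ y' = affine D.swap (x, D.c) := by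
  rcases hy with ⟨t, ht, rfl⟩ | rfl
  · have hc : Filter.Tendsto (fun x => affine D.swap (x, D.c)) (𝓝 t)
        (𝓝 (affine D.swap (t, D.c))) := by
      have := (isParam_affine D.swap).choose_spec.continuous
      exact (by fun_prop : Continuous fun x => affine D.swap (x, D.c)).continuousAt
    refine hc.frequently ((frequently_affine_curve (D := D) (Set.finite_singleton D.b) D.c).mono ?_)
    exact fun x hx => ⟨hx.2, x, hx.1, rfl⟩
  · have hc : Filter.Tendsto (fun x => side D.swap (x, D.c)) (𝓝 0)
        (𝓝 (side D.swap (0, D.c))) := by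
      have := (isParam_side D.swap).choose_spec.continuous
      exact (by fun_prop : Continuous fun x => side D.swap (x, D.c)).continuousAt
    have h : ∃ᶠ x : ℂ in 𝓝 0, x ∈ ({0} : Set ℂ)ᶜ :=
      mem_closure_iff_frequently.1 (dense_compl_singleton 0 0)
    have hb : ∀ᶠ x : ℂ in 𝓝 0, x * D.b ≠ 1 := by
      have : ContinuousAt (fun x : ℂ => x * D.b) 0 := by fun_prop
      exact this.eventually_ne (by simp)
    refine hc.frequently ((h.and_eventually hb).mono fun x hx => ?_)
    have hx0 : x ≠ 0 := hx.1
    have hxb : x⁻¹ ≠ D.b := fun h => hx.2 (by rw [← h, mul_inv_cancel₀ hx0])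
    have he : side D.swap (x, D.c) = affine D.swap (x⁻¹, D.c) := by
      refine (eq_affine_iff (hasCoords_side D.swap _)).2 ⟨hx0, ?_⟩
      simp [hx0]
    refine ⟨?_, x⁻¹, hxb, he⟩
    rw [he]
    exact (side_ne_affine _ _ _ _).symm

/-- The points where the limit of the graph exists and is not isolated in its fibre are the points
of the exceptional curve. -/
theorem exceptional_eq_gammaCurve :
    {y | ∃ y', LimTo D.Graph y y' ∧ AccPt y (Filter.principal {x' | LimTo D.Graph x' y'})} =
      D.gammaCurve := by
  ext y
  constructor
  · rintro ⟨y', h, hacc⟩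
    by_cases hq : y' = D.q
    · subst hq
      exact limTo_q_iff.1 h
    -- Over a value other than `q` every point of the fibre is the value of the inverse map there,
    -- so the fibre is a single point.
    · refine absurd hacc (not_accPt_of_unique fun x' hx' => ?_)
      exact (limTo_inv hx' hq).unique D.inv.dense_graph (limTo_inv h hq)
  · intro hy
    refine ⟨D.q, limTo_q_iff.2 hy, accPt_iff_frequently.2 ((accPt_gammaCurve hy).mono ?_)⟩
    rintro y' ⟨hne, x, hx, rfl⟩
    exact ⟨hne, limTo_q_iff.2 (Or.inl ⟨x, hx, rfl⟩)⟩

/-- The exceptional curve is the closure of its affine part, without the point of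
indeterminacy. -/
theorem closure_diff_eq_gammaCurve :
    closure {y | ∃ x, y = affine D.swap (x, D.c)} \ {y | y = D.p} = D.gammaCurve := by
  ext y
  constructor
  · rintro ⟨hy, hp⟩
    have hp : y ≠ D.p := hp
    obtain ⟨Φ, hΦ⟩ := exists_germ hp
    rw [← limTo_q_iff]
    -- If the value at `y` were not `q`, the same would hold nearby by continuity, but the affine
    -- points of the line go to `q`.
    by_contra hq
    have hne : Φ y ≠ D.q := fun h => hq (h ▸ hΦ.limTo)
    obtain ⟨_, ⟨x, rfl⟩, h1, h2, h3⟩ := ((mem_closure_iff_frequently.1 hy).and_eventually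
      (hΦ.eq.and ((hΦ.hol.continuousAt.eventually_ne hne).and (eventually_ne_nhds hp)))).exists
    have hx : x ≠ D.b := by
      rintro rfl
      exact h3 rfl
    refine h2 ((h1 _ ⟨(x, D.c), hx, rfl, rfl⟩).symm.trans ?_)
    rw [map_of_snd_eq rfl]
    rfl
  · intro hy
    refine ⟨mem_closure_iff_frequently.2 ((accPt_gammaCurve hy).mono ?_), ?_⟩
    · rintro y' ⟨-, x, -, rfl⟩
      exact ⟨x, rfl⟩
    · rintro rfl
      exact p_notMem_gammaCurve hy

/-- Along the exceptional curve, the point `q` pulls back to a principal ideal. -/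
theorem exists_germ_principal {y : Y} (hy : y ∈ D.gammaCurve) :
    ∃ Φ, Germ D.Graph Φ y ∧ Φ y = D.q ∧ Principal (chartAt (ℂ × ℂ) (Φ y)) Φ y := by
  rcases hy with ⟨x, hx, rfl⟩ | rfl
  · have hx' : (x, D.c).1 - D.b ≠ 0 := sub_ne_zero.2 hx
    -- Here `f = q + (y - c) • (1, κ / (x - b))`; the first entry `1` keeps the vector nonzero.
    refine exists_germ_principal_of_param (isParam_affine D.swap) (isParam_affine D.swap)
      (g := D.map) (f := fun z => z.2 - D.c) (w := fun z => (1, D.κ / (z.1 - D.b)))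
      (map_of_snd_eq rfl) (.of_forall fun z x h _ => ?_) (by fun_prop)
      (by fun_prop (disch := assumption)) (by simp) fun z => Prod.ext ?_ ?_
    · rw [(isParam_affine D.swap).choose_spec.injective h]
    · simp [map]
    · simp only [map, Prod.snd_add, Prod.smul_snd, smul_eq_mul]
      ring
  · have h0 : 1 - D.b * (0 : ℂ) ≠ 0 := by simp
    refine exists_germ_principal_of_param (isParam_side D.swap) (isParam_affine D.swap)
      (g := D.sideMap) (f := fun z => z.2 - D.c) (w := fun z => (1, D.κ * z.1 / (1 - D.b * z.1)))
      (by simp [sideMap]) (.of_forall fun z x => affine_sideMap) (by fun_prop)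
      (by fun_prop (disch := assumption)) (by simp) fun z => Prod.ext ?_ ?_
    · simp [sideMap]
    · simp only [sideMap, Prod.snd_add, Prod.smul_snd, smul_eq_mul]
      ring

end LinFrac.Params

/-! ### Lifting the recurrence to the blow-up of an orbit -/

namespace LinFrac

/-- A finite set which contains `p` and `q`, such that the map sends the points of the set different
from `p` to points of the set different from `q`, and the inverse map does the converse. -/
structure IsChain (D : Params) (S : Finset Y) : Prop where
  p_mem : D.p ∈ S
  q_mem : D.q ∈ S
  step : ∀ s ∈ S, s ≠ D.p → ∃ s' ∈ S, s' ≠ D.q ∧ LimTo D.Graph s s'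
  step_inv : ∀ s ∈ S, s ≠ D.q → ∃ s' ∈ S, s' ≠ D.p ∧ LimTo D.inv.Graph s s'

/-- Reversing time exchanges `p` and `q`; this gives the germs of the inverse map for free. -/
theorem IsChain.inv {D : Params} {S : Finset Y} (h : IsChain D S) : IsChain D.inv S where
  p_mem := D.inv_p ▸ h.q_mem
  q_mem := D.inv_q ▸ h.p_mem
  step := by
    rw [D.inv_p, D.inv_q]
    exact h.step_inv
  step_inv := by
    rw [D.inv_p, D.inv_q, D.inv_inv]
    exact h.step

/-- The relation on the blow-up induced by a relation on the surface. -/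
def liftGraph {M : Type*} (S : Finset M) (Γ : M → M → Prop) (x x' : Blowup S) : Prop :=
  Γ x.proj x'.proj ∧ x.proj ∉ S ∧ x'.proj ∉ S

variable {D : Params} {S : Finset Y}

/-- The inverse map sends its whole exceptional curve to `p`, while points of `S` other than `q`
have their inverse images different from `p`. -/
theorem IsChain.eq_q_of_mem (h : IsChain D S) {s : Y} (hs : s ∈ S) (hsγ : s ∈ D.inv.gammaCurve) :
    s = D.q := by
  by_contra hq
  obtain ⟨s', -, hp, hl⟩ := h.step_inv s hs hq
  exact hp ((hl.unique D.inv.dense_graph (Params.limTo_q_iff.2 hsγ)).trans D.inv_q)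

/-- The directions at `p` are sent to the closure of the line `x = c`; apart from `q`, the lift must
not meet blown-up points there. The point at infinity is treated next. -/
theorem IsChain.affine_notMem (h : IsChain D S) {t : ℂ} (ht : t ≠ D.r) :
    affine D.swap (D.c, t) ∉ S := by
  intro hs
  have he : affine D.swap (D.c, t) = affine (!D.swap) (t, D.c) :=
    ((affine_not D.swap (t, D.c))).symm
  have := h.eq_q_of_mem hs (Or.inl ⟨t, ht, he⟩)
  have h2 := congrArg Prod.snd ((isParam_affine D.swap).choose_spec.injective this)
  exact ht h2

theorem IsChain.side_notMem (h : IsChain D S) : side (!D.swap) (0, D.c) ∉ S := fun hs =>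
  Params.side_ne_affine _ _ _ _ (h.eq_q_of_mem hs (Or.inr rfl))

/-- A holomorphic germ with values in `Y` which lifts to the blow-up gives a germ of the lifted
relation. -/
theorem exists_germ_lift {φ : Blowup S → Y} {x : Blowup S} (hφ : HolAt φ x)
    (he : ∀ᶠ x' in 𝓝 x, ∀ y', D.Graph x'.proj y' → y' = φ x')
    (hl : φ x ∉ S ∨ Principal (chartAt (ℂ × ℂ) (φ x)) φ x) :
    ∃ Φ, Germ (liftGraph S D.Graph) Φ x := by
  obtain ⟨Φ, hΦ, hp⟩ : ∃ Φ : Blowup S → Blowup S, HolAt Φ x ∧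
      ∀ᶠ x' in 𝓝 x, (Φ x').proj = φ x' := by
    by_cases hx : φ x ∈ S
    · exact Blowup.exists_lift_of_principal hφ.continuousAt hx (hl.resolve_left fun h => h hx)
    · exact Blowup.exists_lift_of_notMem hφ hx
  refine ⟨Φ, hΦ, ?_⟩
  filter_upwards [he, hp] with x' h1 h2 y' hy'
  have h3 := h1 _ hy'.1
  exact (Blowup.eq_of_proj_eq hy'.2.2 (h2.trans h3.symm)).symm

/-- On the contracted curve the value is `q`, and its ideal becomes principal. Elsewhere the value
is not in `S`: otherwise its inverse image would be in `S` too. -/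
theorem IsChain.germ_of_notMem (h : IsChain D S) {x : Blowup S} (hx : x.proj ∉ S) :
    ∃ Φ, Germ (liftGraph S D.Graph) Φ x := by
  have hπ := Blowup.holAt_proj x
  by_cases hγ : x.proj ∈ D.gammaCurve
  · obtain ⟨φ, hφ, hq, hP⟩ := Params.exists_germ_principal hγ
    exact exists_germ_lift (ContMDiffAt.comp (g := φ) x hφ.hol hπ)
      (hπ.continuousAt.eventually hφ.eq) (Or.inr (hP.precomp hπ))
  · have hp : x.proj ≠ D.p := fun hp => hx (hp ▸ h.p_mem)
    obtain ⟨φ, hφ⟩ := Params.exists_germ hp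
    refine exists_germ_lift (ContMDiffAt.comp (g := φ) x hφ.hol hπ)
      (hπ.continuousAt.eventually hφ.eq) (Or.inl fun hm => ?_)
    have hm : φ x.proj ∈ S := hm
    have hq : φ x.proj ≠ D.q := fun hq => hγ (Params.limTo_q_iff.1 (hq ▸ hφ.limTo))
    obtain ⟨s', hs', -, hl⟩ := h.step_inv _ hm hq
    rw [hl.unique D.inv.dense_graph (Params.limTo_inv hφ.limTo hq)] at hs'
    exact hx hs'

/-- Off `p` a chain point is followed by one different from `q`, so the map is locally biholomorphic
there and transports the principal form of the blow-down. -/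
theorem IsChain.germ_dir (h : IsChain D S) {s : Y} (hs : s ∈ S) (hp : s ≠ D.p) (v : ℙ ℂ (ℂ × ℂ)) :
    ∃ Φ, Germ (liftGraph S D.Graph) Φ (Blowup.dir s hs v) := by
  have hπ := Blowup.holAt_proj (Blowup.dir s hs v)
  obtain ⟨φ, hφ⟩ := Params.exists_germ hp
  obtain ⟨s', hs', hq, hl⟩ := h.step s hs hp
  obtain rfl := hφ.limTo.unique D.dense_graph hl
  obtain ⟨ψ, hψ⟩ := Params.exists_germ (D := D.inv) (y := φ s) (by rwa [D.inv_p])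
  refine exists_germ_lift (φ := fun x => φ x.proj) (ContMDiffAt.comp (g := φ) _ hφ.hol hπ)
    (hπ.continuousAt.eventually hφ.eq) (Or.inr ?_)
  exact (Blowup.principal_proj s hs v).comp (IsManifold.chart_mem_maximalAtlas _)
    hπ.continuousAt (mem_chart_source _ _) (IsManifold.chart_mem_maximalAtlas _)
    hφ.hol hψ.hol (mem_chart_source _ _) (hφ.inverse hψ D.dense_graph_inv)

/-- On the blow-up of `p` the quotient `(y - c) / (x - b)` becomes `w₂ / w₁`, which is holomorphic
or has a holomorphic reciprocal. This resolves the indeterminacy. -/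
theorem IsChain.germ_dir_p (h : IsChain D S) (hs : D.p ∈ S) (v : ℙ ℂ (ℂ × ℂ)) :
    ∃ Φ, Germ (liftGraph S D.Graph) Φ (Blowup.dir D.p hs v) := by
  obtain ⟨A', hA⟩ := isParam_affine D.swap
  obtain ⟨B', hB⟩ := isParam_side (!D.swap)
  set x : Blowup S := Blowup.dir D.p hs v with hx
  have hπ := Blowup.holAt_proj x
  have hproj : x.proj = affine D.swap (D.b, D.c) := rfl
  have hA' : A' x.proj = (D.b, D.c) := by rw [hproj, hA.left_inv]
  have hA'c : HolAt A' x.proj := by rw [hproj]; exact hA.hol_inv _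
  -- The principal form of the blow-down in the preferred chart at `p` is transported to the affine
  -- coordinates `A'`.
  obtain ⟨f, w, hf, hw, hw0, he⟩ :=
    (Blowup.principal_proj D.p hs v).comp (IsManifold.chart_mem_maximalAtlas _)
      hπ.continuousAt (mem_chart_source _ _)
      (IsManifold.chart_mem_maximalAtlas (A' x.proj)) (g := A') (g' := affine D.swap) hA'c
      (hA.hol _) (mem_chart_source _ _) (by rw [hproj]; exact hA.right_inv _)
  have he : ∀ᶠ x' in 𝓝 x, A' x'.proj = (D.b + f x' * (w x').1, D.c + f x' * (w x').2) := by
    filter_upwards [he] with x' hx'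
    have hx' : A' x'.proj = A' x.proj + f x' • w x' := hx'
    rw [hx', hA']
    rfl
  have hf0 : f x = 0 := by
    have := he.self_of_nhds
    rw [hA', Prod.mk.injEq, left_eq_add, left_eq_add, mul_eq_zero, mul_eq_zero] at this
    by_contra hne
    exact hw0 (Prod.ext (this.1.resolve_left hne) (this.2.resolve_left hne))
  have hw1 : ContMDiffAt 𝓘(ℂ, ℂ × ℂ) 𝓘(ℂ, ℂ) ω (fun x => (w x).1) x :=
    ContMDiffAt.comp (g := Prod.fst) (I' := 𝓘(ℂ, ℂ × ℂ)) x contDiff_fst.contDiffAt.contMDiffAt hw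
  have hw2 : ContMDiffAt 𝓘(ℂ, ℂ × ℂ) 𝓘(ℂ, ℂ) ω (fun x => (w x).2) x :=
    ContMDiffAt.comp (g := Prod.snd) (I' := 𝓘(ℂ, ℂ × ℂ)) x contDiff_snd.contDiffAt.contMDiffAt hw
  have hc : ∀ a : ℂ, ContMDiffAt 𝓘(ℂ, ℂ × ℂ) 𝓘(ℂ, ℂ) ω (fun _ : Blowup S => a) x :=
    fun a => contMDiffAt_const
  -- the graph near `x`
  have key : ∀ᶠ x' in 𝓝 x, ∀ y', D.Graph x'.proj y' → f x' * (w x').1 ≠ 0 ∧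
      y' = affine D.swap (D.c + f x' * (w x').2, D.r + D.κ * (w x').2 / (w x').1) := by
    filter_upwards [he] with x' hx'
    rintro y' ⟨z, hz, hxz, rfl⟩
    rw [hxz, hA.left_inv] at hx'
    subst hx'
    have hne : f x' * (w x').1 ≠ 0 := fun h0 => hz (by simp [h0])
    have hne1 : f x' ≠ 0 := left_ne_zero_of_mul hne
    refine ⟨hne, congrArg _ (Prod.ext rfl ?_)⟩
    simp only [Params.map, add_sub_cancel_left]
    rw [mul_left_comm, mul_div_mul_left _ _ hne1]
  -- The direction `w₁ = 0` is sent to the point at infinity of the line `x = c`, which requires the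
  -- reciprocal of the second coordinate.
  by_cases h1 : (w x).1 = 0
  · have h2 : (w x).2 ≠ 0 := fun h2 => hw0 (Prod.ext h1 h2)
    have hd : D.r * (w x).1 + D.κ * (w x).2 ≠ 0 := by
      rw [h1, mul_zero, zero_add]
      exact mul_ne_zero D.ne h2
    have hdc : ContMDiffAt 𝓘(ℂ, ℂ × ℂ) 𝓘(ℂ, ℂ) ω
      (fun x => D.r * (w x).1 + D.κ * (w x).2) x := ((hc _).mul hw1).add ((hc _).mul hw2)
    have hζ : HolAt (fun x' => ((w x').1 / (D.r * (w x').1 + D.κ * (w x').2),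
        D.c + f x' * (w x').2)) x :=
      (hw1.div₀ hdc hd).prodMk_space ((hc _).add (hf.mul hw2))
    refine exists_germ_lift (ContMDiffAt.comp (g := side (!D.swap)) x (hB.hol _) hζ) ?_
      (Or.inl ?_)
    · filter_upwards [key, hdc.continuousAt.eventually_ne hd] with x' hx' hd' y' hy'
      obtain ⟨hne, rfl⟩ := hx' y' hy'
      have hne1 : (w x').1 ≠ 0 := right_ne_zero_of_mul hne
      refine ((eq_affine_iff (Params.hasCoords_side_not D.swap _)).2
        ⟨div_ne_zero hne1 hd', Prod.ext ?_ ?_⟩).symm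
      · exact (mul_div_cancel_left₀ _ (div_ne_zero hne1 hd')).symm
      · simp only [one_div_div]
        rw [add_div, mul_div_cancel_right₀ _ hne1]
    · have := h.side_notMem
      simpa [h1, hf0] using this
  · obtain ⟨ζ, hζe⟩ : ∃ ζ : Blowup S → ℂ × ℂ, ∀ x', ζ x' =
        (D.c + f x' * (w x').2, D.r + D.κ * (w x').2 / (w x').1) := ⟨_, fun _ => rfl⟩
    have hζ : HolAt ζ x := by
      rw [funext hζe]
      exact ((hc _).add (hf.mul hw2)).prodMk_space ((hc _).add (((hc _).mul hw2).div₀ hw1 h1))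
    have hζx : ζ x = (D.c, D.r + D.κ * (w x).2 / (w x).1) := by rw [hζe, hf0, zero_mul, add_zero]
    refine exists_germ_lift (φ := fun x' => affine D.swap (ζ x'))
      (ContMDiffAt.comp (g := affine D.swap) x (hA.hol _) hζ)
      (key.mono fun x' hx' y' hy' => by rw [hζe]; exact (hx' y' hy').2) ?_
    -- This direction is tangent to the contracted curve and is sent to `q`. The image is `q + w₂ •
    -- (f, κ / w₁)`, whose vector is nonzero because `κ ≠ 0`.
    by_cases h2 : (w x).2 = 0
    · right
      have hw' : HolAt (fun x' => (f x', D.κ / (w x').1)) x :=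
        hf.prodMk_space ((hc _).div₀ hw1 h1)
      refine hA.principal (ζ := ζ) (h := fun x' => (w x').2)
        (w := fun x' => (f x', D.κ / (w x').1)) hζ.continuousAt hw2 hw' ?_
        (.of_forall fun x' => ?_)
      · intro h0
        exact div_ne_zero D.ne h1 (congrArg Prod.snd h0)
      · rw [hζx, h2, hζe]
        refine Prod.ext ?_ ?_
        · simp only [Prod.fst_add, Prod.smul_fst, smul_eq_mul]
          ring
        · simp only [Prod.snd_add, Prod.smul_snd, smul_eq_mul]
          ring
    · left
      rw [hζx]
      refine h.affine_notMem ?_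
      simp [D.ne, h1, h2]

theorem IsChain.exists_germ (h : IsChain D S) (x : Blowup S) :
    ∃ Φ, Germ (liftGraph S D.Graph) Φ x := by
  rcases x with ⟨y, hy⟩ | ⟨s, hs, v⟩
  · exact h.germ_of_notMem (x := .pt y hy) hy
  · by_cases hp : s = D.p
    · subst hp
      exact h.germ_dir_p hs v
    · exact h.germ_dir hs hp v

/-- The first coordinate of the image is the second coordinate of the point, so avoiding finitely
many values of the latter keeps the image off `S`. -/
theorem dense_liftGraph_inv (D : Params) (S : Finset Y) :
    Dense {x : Blowup S | ∃ x', liftGraph S D.Graph x x' ∧ liftGraph S D.inv.Graph x' x} := by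
  obtain ⟨A', hA⟩ := isParam_affine D.swap
  -- the `x`-coordinates of the affine points of `S`
  set F : Set ℂ := (fun s => (A' s).1) '' (S : Set Y) with hF
  have hFf : F.Finite := S.finite_toSet.image _
  refine (Blowup.dense_preimage (S := S)
    (D.dense_graph_inv_off Set.finite_empty hFf)).mono ?_
  rintro x ⟨⟨y', ⟨z, -, hz, -, rfl⟩, h1, h2⟩, hx⟩
  have hS : affine D.swap (D.map z) ∉ S := by
    intro hm
    refine hz ⟨_, hm, ?_⟩
    dsimp only
    rw [hA.left_inv]
    rfl
  exact ⟨.pt _ hS, ⟨h1, hx, hS⟩, ⟨h2, hS, hx⟩⟩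

theorem dense_inv_liftGraph (D : Params) (S : Finset Y) :
    Dense {x : Blowup S | ∃ x', liftGraph S D.inv.Graph x x' ∧ liftGraph S D.Graph x' x} := by
  simpa only [D.inv_inv] using dense_liftGraph_inv D.inv S

/-- On the blow-up of a chain, the map is biholomorphic and has no exceptional curves. -/
theorem IsChain.exists_diffeomorph (h : IsChain D S) :
    (∃ F : Blowup S ≃ₘ^ω⟮𝓘(ℂ, ℂ × ℂ), 𝓘(ℂ, ℂ × ℂ)⟯ Blowup S,
      (∀ x, LimTo (liftGraph S D.Graph) x (F x)) ∧
        ∀ x, LimTo (liftGraph S D.inv.Graph) x (F.symm x)) ∧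
    (∀ x y, LimTo (liftGraph S D.Graph) x y →
      ¬ AccPt x (Filter.principal {x' | LimTo (liftGraph S D.Graph) x' y})) ∧
    ∀ x y, LimTo (liftGraph S D.inv.Graph) x y →
      ¬ AccPt x (Filter.principal {x' | LimTo (liftGraph S D.inv.Graph) x' y}) := by
  have hd := dense_liftGraph_inv D S
  have hd' := dense_inv_liftGraph D S
  obtain ⟨F, hF, hF'⟩ := _root_.exists_diffeomorph h.exists_germ h.inv.exists_germ hd hd'
  have hd1 : Dense {x : Blowup S | ∃ x', liftGraph S D.Graph x x'} := by
    refine hd.mono ?_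
    rintro x ⟨x', hx⟩
    exact ⟨x', hx.1⟩
  have hd2 : Dense {x : Blowup S | ∃ x', liftGraph S D.inv.Graph x x'} := by
    refine hd'.mono ?_
    rintro x ⟨x', hx⟩
    exact ⟨x', hx.1⟩
  refine ⟨⟨F, hF, hF'⟩, fun x y hxy => not_accPt_of_unique fun x' hx' => F.injective ?_,
    fun x y hxy => not_accPt_of_unique fun x' hx' => F.symm.injective ?_⟩
  · exact ((hF x').unique hd1 hx').trans (hxy.unique hd1 (hF x))
  · exact ((hF' x').unique hd2 hx').trans (hxy.unique hd2 (hF' x))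

end LinFrac

/-! ### The recurrence in affine coordinates -/

/-- A blown-up point has at least two directions above it, so being alone in a fibre upstairs means
being alone downstairs and not blown up. -/
theorem isGeneric_comp_proj {M Z : Type*} (S : Finset M) (ρ : M → Z) (b : Blowup S) :
    (∀ x', ρ x'.proj = ρ b.proj → x' = b) ↔ (∀ y, ρ y = ρ b.proj → y = b.proj) ∧ b.proj ∉ S := by
  constructor
  · intro h
    refine ⟨fun y hy => ?_, ?_⟩
    · by_cases hyS : y ∈ S
      · exact congrArg Blowup.proj
          (h (.dir y hyS (Projectivization.mk ℂ (1, 0) (by simp))) hy)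
      · exact congrArg Blowup.proj (h (.pt y hyS) hy)
    · intro hb
      have h1 := h (.dir b.proj hb (Projectivization.mk ℂ (1, 0) (by simp))) rfl
      have h2 := h (.dir b.proj hb (Projectivization.mk ℂ (0, 1) (by simp))) rfl
      have h3 := h1.trans h2.symm
      simp [Projectivization.mk_eq_mk_iff'] at h3
  · rintro ⟨h, hb⟩ x' hx'
    exact Blowup.eq_of_proj_eq hb (h _ hx')

theorem mem_projLine_iff {P : P2} {c v : Fin 3 → ℂ} (hP : HasCoords P v) :
    P ∈ projLine c ↔ c ⬝ᵥ v = 0 := by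
  obtain ⟨t, ht, h⟩ := (hasCoords_rep P).smul_eq hP
  rw [h, dotProduct_smul, smul_eq_zero_iff_right ht]
  rfl

/-- Since `G` is homogeneous of degree `2`, the choice of homogeneous coordinates does not matter.
-/
theorem ratMapsTo_iff {G : (Fin 3 → ℂ) → (Fin 3 → ℂ)} (hG : ∀ (t : ℂ) v, G (t • v) = t ^ 2 • G v)
    {P Q : P2} {v : Fin 3 → ℂ} (hP : HasCoords P v) : RatMapsTo G P Q ↔ HasCoords Q (G v) := by
  constructor
  · rintro ⟨w, hw, hGw, rfl, rfl⟩
    obtain ⟨t, ht, rfl⟩ := hP.smul_eq (w := w) ⟨hw, rfl⟩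
    have := HasCoords.smul (P := Projectivization.mk ℂ _ hGw) ⟨hGw, rfl⟩
      (t := (t ^ 2)⁻¹) (by simpa using ht)
    have he : (t ^ 2)⁻¹ • G (t • v) = G v := by
      rw [hG, inv_smul_smul₀ (pow_ne_zero 2 ht)]
    rwa [he] at this
  · rintro ⟨hw, hQ⟩
    obtain ⟨hv, hP⟩ := hP
    exact ⟨v, hv, hw, hP, hQ⟩

namespace LinFrac

theorem isGeneric_projY_iff {y : Y} :
    IsGeneric projY y ↔ projY y ≠ eOne ∧ projY y ≠ eTwo := by
  have := isGeneric_comp_proj _ id y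
  simp only [id, imp_self, implies_true, true_and] at this
  exact this.trans (by simp [projY])

theorem exists_base_of_coords {P : P2} {τ : Bool} {t u : ℂ} (hP : HasCoords P (coords τ 0 t u))
    (h : t = 0 ∨ u = 0) : P = eOne ∨ P = eTwo := by
  obtain ⟨hv, rfl⟩ := hP
  have key : ∀ s : ℂ, (∃ hv : coords false 0 s 0 ≠ 0,
      Projectivization.mk ℂ _ hv = eOne) ∨ s = 0 := by
    intro s
    by_cases hs : s = 0
    · exact Or.inr hs
    · obtain ⟨hv, hP⟩ := hasCoords_eOne.smul hs
      rw [smul_coords] at hv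
      refine Or.inl ⟨by simpa using hv, ?_⟩
      rw [← hP]
      congr 1
      rw [smul_coords]
      simp
  have key' : ∀ s : ℂ, (∃ hv : coords false 0 0 s ≠ 0,
      Projectivization.mk ℂ _ hv = eTwo) ∨ s = 0 := by
    intro s
    by_cases hs : s = 0
    · exact Or.inr hs
    · obtain ⟨hv, hP⟩ := hasCoords_eTwo.smul hs
      rw [smul_coords] at hv
      refine Or.inl ⟨by simpa using hv, ?_⟩
      rw [← hP]
      congr 1
      rw [smul_coords]
      simp
  have h0 : ∀ τ, coords τ 0 0 0 = 0 := by
    intro τ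
    cases τ <;> simp [coords]
  rcases h with rfl | rfl
  · rcases τ
    · rcases key' u with ⟨_, h⟩ | rfl
      · exact Or.inr h
      · exact absurd (h0 _) hv
    · rcases key u with ⟨_, h⟩ | rfl
      · exact Or.inl h
      · exact absurd (h0 _) hv
  · rcases τ
    · rcases key t with ⟨_, h⟩ | rfl
      · exact Or.inl h
      · exact absurd (h0 _) hv
    · rcases key' t with ⟨_, h⟩ | rfl
      · exact Or.inr h
      · exact absurd (h0 _) hv

theorem isGeneric_affine (τ : Bool) (z : ℂ × ℂ) : IsGeneric projY (affine τ z) := by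
  rw [isGeneric_projY_iff, ← not_or]
  exact fun h => one_ne_zero (mem_base_of_coords (hasCoords_affine τ z) h).1

theorem hasCoords_iff_eq_affine {y : Y} {τ : Bool} {x₀ x₁ x₂ : ℂ} (h0 : x₀ ≠ 0) :
    HasCoords (projY y) (coords τ x₀ x₁ x₂) ↔ y = affine τ (x₁ / x₀, x₂ / x₀) := by
  constructor
  · exact fun h => (eq_affine_iff h).2 ⟨h0, rfl⟩
  · rintro rfl
    have := (hasCoords_affine τ (x₁ / x₀, x₂ / x₀)).smul h0
    rw [smul_coords] at this
    simpa [mul_div_cancel₀ _ h0] using this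

/-- A rational map which is given by `D` in affine coordinates and contracts the line at infinity
has the graph of `D`. -/
theorem genericGraph_eq {D : Params} {G : (Fin 3 → ℂ) → (Fin 3 → ℂ)} {a : ℂ} (ha : a ≠ 0)
    (hG : ∀ (t : ℂ) v, G (t • v) = t ^ 2 • G v)
    (hG1 : ∀ x y, G (coords D.swap 1 x y) = a • coords D.swap (x - D.b) (y * (x - D.b))
      (D.r * (x - D.b) + D.κ * (y - D.c)))
    (hG0 : ∀ x y, ∃ t, G (coords D.swap 0 x y) = coords D.swap 0 t 0) :
    GenericGraph projY G = D.Graph := by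
  have hG1' : ∀ z : ℂ × ℂ, ∀ Q, RatMapsTo G (projY (affine D.swap z)) Q ↔
      HasCoords Q (coords D.swap (z.1 - D.b) (z.2 * (z.1 - D.b))
        (D.r * (z.1 - D.b) + D.κ * (z.2 - D.c))) := by
    intro z Q
    rw [ratMapsTo_iff hG (hasCoords_affine D.swap z), hG1]
    constructor
    · intro h
      have := h.smul (inv_ne_zero ha)
      rwa [inv_smul_smul₀ ha] at this
    · exact fun h => h.smul ha
  have hmap : ∀ z : ℂ × ℂ, z.1 - D.b ≠ 0 → (z.2 * (z.1 - D.b) / (z.1 - D.b),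
      (D.r * (z.1 - D.b) + D.κ * (z.2 - D.c)) / (z.1 - D.b)) = D.map z := by
    intro z hz
    refine Prod.ext ?_ ?_
    · exact mul_div_cancel_right₀ _ hz
    · simp only [Params.map]
      rw [add_div, mul_div_cancel_right₀ _ hz]
  ext y y'
  constructor
  · rintro ⟨hy, hy', hR⟩
    rw [isGeneric_projY_iff, ← not_or] at hy hy'
    obtain ⟨x₀, x₁, x₂, hv⟩ := exists_eq_coords D.swap (projY y).rep
    have hc := hasCoords_rep (projY y)
    rw [hv] at hc
    -- Points at infinity, and below also points of the pole line, have images only among `e₁` and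
    -- `e₂`, so they contribute nothing to the generic graph.
    by_cases h0 : x₀ = 0
    · subst h0
      rw [ratMapsTo_iff hG hc] at hR
      obtain ⟨t, ht⟩ := hG0 x₁ x₂
      rw [ht] at hR
      exact absurd (exists_base_of_coords hR (Or.inr rfl)) hy'
    · rw [hasCoords_iff_eq_affine h0] at hc
      subst hc
      rw [hG1'] at hR
      by_cases hb : x₁ / x₀ - D.b = 0
      · simp only [hb, mul_zero] at hR
        exact absurd (exists_base_of_coords hR (Or.inl rfl)) hy'
      · refine ⟨_, sub_ne_zero.1 hb, rfl, ?_⟩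
        rw [hasCoords_iff_eq_affine hb] at hR
        rw [hR, ← hmap _ hb]
  · rintro ⟨z, hz, rfl, rfl⟩
    have hb : z.1 - D.b ≠ 0 := sub_ne_zero.2 hz
    refine ⟨isGeneric_affine _ _, isGeneric_affine _ _, ?_⟩
    rw [hG1', hasCoords_iff_eq_affine hb, hmap z hb]

/-- The part of the line `x₂ = c x₀` in the affine plane. -/
theorem generic_projLine_eq {τ : Bool} {γ : Fin 3 → ℂ} {a c : ℂ} (ha : a ≠ 0)
    (hγ : ∀ x₀ x₁ x₂, γ ⬝ᵥ coords τ x₀ x₁ x₂ = a * (x₂ - c * x₀)) :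
    {y : Y | IsGeneric projY y ∧ projY y ∈ projLine γ} = {y | ∃ x, y = affine τ (x, c)} := by
  ext y
  constructor
  · rintro ⟨hy, hm⟩
    rw [isGeneric_projY_iff, ← not_or] at hy
    obtain ⟨x₀, x₁, x₂, hv⟩ := exists_eq_coords τ (projY y).rep
    have hc := hasCoords_rep (projY y)
    rw [hv] at hc
    rw [mem_projLine_iff hc, hγ, mul_eq_zero, sub_eq_zero] at hm
    have hm := hm.resolve_left ha
    subst hm
    by_cases h0 : x₀ = 0
    · subst h0
      exact absurd (exists_base_of_coords hc (Or.inr (mul_zero c))) hy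
    · rw [hasCoords_iff_eq_affine h0, mul_div_cancel_right₀ _ h0] at hc
      exact ⟨_, hc⟩
  · rintro ⟨x, rfl⟩
    refine ⟨isGeneric_affine _ _, ?_⟩
    rw [mem_projLine_iff (hasCoords_affine τ _), hγ]
    simp

/-- The point `p` is removed because it lies in the closure of the line, but the induced map is not
defined there. -/
theorem exceptionalLocus_eq {D : Params} {G : (Fin 3 → ℂ) → (Fin 3 → ℂ)}
    (hG : GenericGraph projY G = D.Graph) {γ v : Fin 3 → ℂ} {a : ℂ} (ha : a ≠ 0)
    (hγ : ∀ x₀ x₁ x₂, γ ⬝ᵥ coords D.swap x₀ x₁ x₂ = a * (x₂ - D.c * x₀))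
    (hv : ∀ y, HasCoords (projY y) v ↔ y = D.p) :
    exceptionalLocus projY G = strictTransform projY (projLine γ) \
      {y | HasCoords (projY y) v} := by
  have h1 : exceptionalLocus projY G = {y | ∃ y', LimTo (GenericGraph projY G) y y' ∧
      AccPt y (Filter.principal {x' | LimTo (GenericGraph projY G) x' y'})} := rfl
  rw [h1, hG, Params.exceptional_eq_gammaCurve, strictTransform, generic_projLine_eq ha hγ]
  simp only [hv]
  exact Params.closure_diff_eq_gammaCurve.symm

/-- Genericity in `X` is genericity in `Y` together with being off the orbit, so working over the
plane or over `Y` gives the same relation. -/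
theorem genericGraph_projX_eq {n : ℕ} (o : Fin (n + 1) → Y) {G : (Fin 3 → ℂ) → (Fin 3 → ℂ)}
    {Γ : Y → Y → Prop} (hG : GenericGraph projY G = Γ) :
    GenericGraph (projX o) G = liftGraph _ Γ := by
  subst hG
  have hg : ∀ x : X o, IsGeneric (projX o) x ↔ IsGeneric projY x.proj ∧ x.proj ∉ _ :=
    fun x => isGeneric_comp_proj _ projY x
  ext x x'
  simp only [GenericGraph, hg, liftGraph, projX]
  tauto

/-! ### Orbits -/

/-- An orbit segment of the map from `q` to `p`. -/
structure OrbitSegment (D : Params) {n : ℕ} (o : Fin (n + 1) → Y) : Prop where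
  start : o 0 = D.q
  step : ∀ j : Fin n, LimTo D.Graph (o j.castSucc) (o j.succ)
  finish : o (Fin.last n) = D.p

namespace OrbitSegment

variable {D : Params} {n : ℕ} {o o' : Fin (n + 1) → Y}

theorem unique (h : OrbitSegment D o) (h' : OrbitSegment D o') : o = o' := by
  funext i
  induction i using Fin.induction with
  | zero => rw [h.start, h'.start]
  | succ i ih =>
    refine (h.step i).unique D.dense_graph ?_
    rw [ih]
    exact h'.step i

/-- No value is defined at `p`, so the orbit cannot continue after reaching it. -/
theorem eq_last (h : OrbitSegment D o) {i : Fin (n + 1)} (hi : o i = D.p) : i = Fin.last n := by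
  by_contra hne
  obtain ⟨j, rfl⟩ := Fin.exists_castSucc_eq.2 hne
  have := h.step j
  rw [hi] at this
  exact Params.not_limTo_p _ this

/-- A return to `q` at time `i` would make the orbit repeat from there, so `p` would already occur
at time `n - i`; hence `i = 0`. -/
theorem eq_zero (h : OrbitSegment D o) {i : Fin (n + 1)} (hi : o i = D.q) : i = 0 := by
  obtain ⟨i, hin⟩ := i
  have key : ∀ k (hk : i + k < n + 1), o ⟨i + k, hk⟩ = o ⟨k, by omega⟩ := by
    intro k
    induction k with
    | zero => exact fun hk => hi.trans h.start.symm
    | succ k ih =>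
      intro hk
      have h1 := h.step ⟨i + k, by omega⟩
      have h2 := h.step ⟨k, by omega⟩
      have h3 : o (Fin.castSucc ⟨i + k, by omega⟩) = o (Fin.castSucc ⟨k, by omega⟩) :=
        ih (by omega)
      rw [h3] at h1
      exact h1.unique D.dense_graph h2
  have h1 := key (n - i) (by omega)
  have h2 : (⟨i + (n - i), by omega⟩ : Fin (n + 1)) = Fin.last n :=
    Fin.ext (by simp only [Fin.val_last]; omega)
  rw [h2, h.finish] at h1
  have h3 := congrArg Fin.val (h.eq_last h1.symm)
  simp only [Fin.val_last] at h3
  exact Fin.ext (by simp only [Fin.val_zero]; omega)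

-- The chain conditions ask that `p` occur only at the end and `q` only at the start; off `q`, the
-- backward steps are the reversed forward ones.
open Classical in
theorem isChain (h : OrbitSegment D o) : IsChain D (Finset.univ.image o) where
  p_mem := Finset.mem_image.2 ⟨_, Finset.mem_univ _, h.finish⟩
  q_mem := Finset.mem_image.2 ⟨_, Finset.mem_univ _, h.start⟩
  step := by
    intro s hs hp
    obtain ⟨i, -, rfl⟩ := Finset.mem_image.1 hs
    have hi : i ≠ Fin.last n := by
      rintro rfl
      exact hp h.finish
    obtain ⟨j, rfl⟩ := Fin.exists_castSucc_eq.2 hi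
    exact ⟨o j.succ, Finset.mem_image_of_mem _ (Finset.mem_univ _),
      fun hq => Fin.succ_ne_zero j (h.eq_zero hq), h.step j⟩
  step_inv := by
    intro s hs hq
    obtain ⟨i, -, rfl⟩ := Finset.mem_image.1 hs
    have hi : i ≠ 0 := by
      rintro rfl
      exact hq h.start
    obtain ⟨j, rfl⟩ := Fin.exists_succ_eq.2 hi
    exact ⟨o j.castSucc, Finset.mem_image_of_mem _ (Finset.mem_univ _),
      fun hp => Fin.castSucc_ne_last j (h.eq_last hp), Params.limTo_inv (h.step j) hq⟩

end OrbitSegment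

/-- The parameters of the recurrence with `β₂ = 0`. -/
noncomputable def params (α β : Fin 3 → ℂ) (h : α 2 / β 1 ≠ 0) : Params where
  swap := false
  b := -β 0 / β 1
  c := (α 1 * β 0 - α 0 * β 1) / (β 1 * α 2)
  r := α 1 / β 1
  κ := α 2 / β 1
  ne := h

/-! ### Homogeneous data with `β₂ = 0` in normal form -/

section

variable {α β : Fin 3 → ℂ} (hα : α 2 ≠ 0) (hβ : β 1 ≠ 0) (h2 : β 2 = 0)

include hα hβ h2

/-- Division with remainder: `α₀ + α₁ x + α₂ y = r (β₀ + β₁ x) + α₂ (y - c)` for `r = α₁ / β₁`,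
which determines `c`; the denominator is `β₁ (x - b)`. -/
theorem genericGraph_recMap :
    GenericGraph projY (recMap α β) = (params α β (div_ne_zero hα hβ)).Graph := by
  refine genericGraph_eq (a := β 1) hβ (fun t v => ?_) (fun x y => ?_)
    (fun x y => ⟨y * (β 1 * x), ?_⟩)
  · ext i
    fin_cases i <;> simp [recMap, dotProduct_smul] <;> ring
  · simp only [params, smul_coords]
    ext i
    fin_cases i <;> simp [recMap, coords, dotProduct, Fin.sum_univ_three, h2]
    · field_simp
      ring
    · field_simp
      ring
    · field_simp
      ring
  · ext i
    fin_cases i <;> simp [params, recMap, coords, dotProduct, Fin.sum_univ_three, h2]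

theorem genericGraph_invMap :
    GenericGraph projY (invMap α β) = (params α β (div_ne_zero hα hβ)).inv.Graph := by
  refine genericGraph_eq (a := β 1) hβ (fun t v => ?_) (fun x y => ?_)
    (fun x y => ⟨y * (β 1 * x), ?_⟩)
  · ext i
    fin_cases i <;> simp [invMap, dotProduct, Fin.sum_univ_three, h2] <;> ring
  · simp only [params, Params.inv, smul_coords]
    ext i
    fin_cases i <;> simp [invMap, coords, dotProduct, Fin.sum_univ_three, h2]
    · field_simp
      ring
    · field_simp
      ring
    · field_simp
      ring
  · ext i
    fin_cases i <;> simp [params, Params.inv, invMap, coords, dotProduct, Fin.sum_univ_three, h2]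

theorem hasCoords_pVec_iff (y : Y) :
    HasCoords (projY y) (pVec α β) ↔ y = (params α β (div_ne_zero hα hβ)).p := by
  have h : pVec α β = coords false (β 1 * α 2) (-β 0 * α 2) (α 1 * β 0 - α 0 * β 1) := by
    simp [pVec, coords, h2]
  rw [h, hasCoords_iff_eq_affine (mul_ne_zero hβ hα), mul_div_mul_right _ _ hα]
  rfl

theorem hasCoords_qVec_iff (y : Y) :
    HasCoords (projY y) (qVec α β) ↔ y = (params α β (div_ne_zero hα hβ)).q := by
  have h : qVec α β = coords false (β 1 * (β 1 * α 2)) (β 1 * (α 1 * β 0 - α 0 * β 1))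
      (α 1 * (β 1 * α 2)) := by
    simp [qVec, coords, h2]
  rw [h, hasCoords_iff_eq_affine (mul_ne_zero hβ (mul_ne_zero hβ hα)), mul_div_mul_left _ _ hβ,
    mul_div_mul_right _ _ (mul_ne_zero hβ hα)]
  rfl

theorem gammaVec_dotProduct (x₀ x₁ x₂ : ℂ) :
    gammaVec α β ⬝ᵥ coords (params α β (div_ne_zero hα hβ)).swap x₀ x₁ x₂ =
      β 1 * α 2 * (x₂ - (params α β (div_ne_zero hα hβ)).c * x₀) := by
  simp only [params]
  simp [gammaVec, coords, dotProduct, Fin.sum_univ_three, h2]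
  field_simp
  ring

theorem cVec_dotProduct (x₀ x₁ x₂ : ℂ) :
    cVec α β ⬝ᵥ coords (params α β (div_ne_zero hα hβ)).inv.swap x₀ x₁ x₂ =
      -(β 1 * α 2) * (x₂ - (params α β (div_ne_zero hα hβ)).inv.c * x₀) := by
  simp only [params, Params.inv]
  simp [cVec, coords, dotProduct, Fin.sum_univ_three, h2]
  field_simp
  ring

theorem isOrbit_iff {n : ℕ} (o : Fin (n + 1) → Y) :
    IsOrbit α β o ↔ OrbitSegment (params α β (div_ne_zero hα hβ)) o := by
  have hl : InducedMapsTo projY (recMap α β) =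
      LimTo (params α β (div_ne_zero hα hβ)).Graph := by
    rw [← genericGraph_recMap hα hβ h2]
    rfl
  constructor
  · intro h
    exact ⟨(hasCoords_qVec_iff hα hβ h2 _).1 h.start, by rw [← hl]; exact h.step,
      (hasCoords_pVec_iff hα hβ h2 _).1 h.finish⟩
  · intro h
    exact ⟨(hasCoords_qVec_iff hα hβ h2 _).2 h.start, by rw [hl]; exact h.step,
      (hasCoords_pVec_iff hα hβ h2 _).2 h.finish⟩

end

end LinFrac

/-! ### The theorem -/

theorem proposition4p3 (n : ℕ) (α β : Fin 3 → ℂ) (hαβ : Admissible α β) (hV : (α, β) ∈ V n) :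
    -- on `Y`, the line `γ ⬝ x = 0` is the only exceptional curve of `f`, and the line `C ⬝ x = 0`
    -- is the only exceptional curve of the inverse of `f`
    (exceptionalLocus projY (recMap α β) =
      strictTransform projY (projLine (gammaVec α β)) \ {y | HasCoords (projY y) (pVec α β)}) ∧
    (exceptionalLocus projY (invMap α β) =
      strictTransform projY (projLine (cVec α β)) \ {y | HasCoords (projY y) (qVec α β)}) ∧
    -- the orbit of `q` up to `p` is unique (it exists by assumption)
    (∃! o : Fin (n + 1) → Y, IsOrbit α β o) ∧
    -- on the blow-up `X` of `Y` at this orbit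
    ∀ o : Fin (n + 1) → Y, IsOrbit α β o →
      -- the induced maps are everywhere defined, holomorphic and inverse to each other
      (∃ F : X o ≃ₘ^ω⟮𝓘(ℂ, ℂ × ℂ), 𝓘(ℂ, ℂ × ℂ)⟯ X o,
        (∀ x, InducedMapsTo (projX o) (recMap α β) x (F x)) ∧
        (∀ x, InducedMapsTo (projX o) (invMap α β) x (F.symm x))) ∧
      -- and there are no exceptional curves left
      exceptionalLocus (projX o) (recMap α β) = ∅ ∧
      exceptionalLocus (projX o) (invMap α β) = ∅ := by
  obtain ⟨h2, o, ho⟩ := hV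
  replace h2 : β 2 = 0 := h2
  have hα : α 2 ≠ 0 := fun h => hαβ.ne_two (Prod.ext h h2)
  have hβ : β 1 ≠ 0 := fun h => hαβ.beta_ne (Prod.ext h h2)
  have hf := genericGraph_recMap hα hβ h2
  have hg := genericGraph_invMap hα hβ h2
  refine ⟨?_, ?_, ⟨o, ho, fun o' ho' => ?_⟩, fun o ho => ?_⟩
  · exact exceptionalLocus_eq hf (mul_ne_zero hβ hα) (gammaVec_dotProduct hα hβ h2)
      (hasCoords_pVec_iff hα hβ h2)
  · refine exceptionalLocus_eq hg (neg_ne_zero.2 (mul_ne_zero hβ hα)) (cVec_dotProduct hα hβ h2)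
      fun y => ?_
    rw [hasCoords_qVec_iff hα hβ h2, Params.inv_p]
  · exact ((isOrbit_iff hα hβ h2 o').1 ho').unique ((isOrbit_iff hα hβ h2 o).1 ho)
  · obtain ⟨hF, h3, h4⟩ := ((isOrbit_iff hα hβ h2 o).1 ho).isChain.exists_diffeomorph
    have hf' := genericGraph_projX_eq o hf
    have hg' := genericGraph_projX_eq o hg
    rw [← hf', ← hg'] at hF
    rw [← hf'] at h3
    rw [← hg'] at h4
    refine ⟨hF, Set.eq_empty_of_forall_notMem ?_, Set.eq_empty_of_forall_notMem ?_⟩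
    · rintro x ⟨y, hy, hacc⟩
      exact h3 x y hy hacc
    · rintro x ⟨y, hy, hacc⟩
      exact h4 x y hy hacc
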